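/- Let $\alpha>0$ and, for $t>0$, let $w(x,t)=(1-x^2)^\alpha e^{-t/x^2}$ on $[-1,1]$. Let $P_n(x,t)$, $n=0,1,2,\dots$, be the monic polynomials of degree $n$ in $x$ that are orthogonal with respect to $w(x,t)\,dx$ on $[-1,1]$, let $h_n(t)=\int_{-1}^{1}P_n(x,t)^2\,w(x,t)\,dx$, and put $$R_n(t)=\frac{2t}{h_n(t)}\int_{-1}^{1}\frac{P_n(y,t)^2\,w(y,t)}{y^2}\,dy,\qquad S_n(t)=1+\frac{R_n(t)}{2n+2\alpha+1}.$$ Then, for every integer $n\ge 0$, the following hold. (i) $R_n$ is twice differentiable on $(0,\infty)$ and for all $t>0$, writing $R=R_n(t)$, $R'=R_n'(t)$, $R''=R_n''(t)$, $$\begin{aligned} &8t^2R\,(2n+2\alpha+1+R)\,R''-4t^2(4n+4\alpha+2+3R)(R')^2+8t(2n+2\alpha+1+R)\,R\,R'\\ &-R^5-2(2n+2\alpha+1)R^4-\left[4n^2+4(2\alpha+1)n+4\alpha+1-4t^2-4(-1)^nt\right]R^3\\ &+8t(2n+2\alpha+1)\left[(-1)^n+2t\right]R^2+4t(2n+2\alpha+1)^2\left[(-1)^n+5t\right]R+8t^2(2n+2\alpha+1)^3=0.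 \end{aligned}$$ (ii) $S_n$ is twice differentiable on $(0,\infty)$, takes neither of the values $0$ and $1$ there, and for all $t>0$, writing $S=S_n(t)$, $S'=S_n'(t)$, $S''=S_n''(t)$, $$S''=\frac{(3S-1)(S')^2}{2S(S-1)}-\frac{S'}{t}+\frac{(S-1)^2}{t^2}\left(\frac{(2n+2\alpha+1)^2S}{8}-\frac{\alpha^2}{2S}\right)-\frac{(-1)^nS}{2t}-\frac{S(S+1)}{2(S-1)};$$ that is, $S_n$ solves on $(0,\infty)$ the fifth Painlevé equation $$y''=\left(\frac1{2y}+\frac1{y-1}\right)(y')^2-\frac{y'}{t}+\frac{(y-1)^2}{t^2}\left(ay+\frac by\right)+\frac{c\,y}{t}+\frac{d\,y(y+1)}{y-1}$$ with parameters $(a,b,c,d)=\left(\frac{(2n+2\alpha+1)^2}{8},-\frac{\alpha^2}{2},-\frac{(-1)^n}{2},-\frac12\right)$. -/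

import Mathlib

open Polynomial

noncomputable section

namespace SingularJacobi

/-- The singularly perturbed Jacobi weight `w(x,t) = (1 - x²)^α exp(-t / x²)` on `[-1,1]`
(its value at the single point `x = 0` plays no role in the integrals below). -/
def weight (α t x : ℝ) : ℝ :=
  (1 - x ^ 2) ^ α * Real.exp (-t / x ^ 2)

/-- The bilinear form `⟨p, q⟩ = ∫_{-1}^{1} p(x) q(x) w(x,t) dx` on real polynomials. -/
def pairing (α t : ℝ) (p q : ℝ[X]) : ℝ :=
  ∫ x in (-1 : ℝ)..1, p.eval x * q.eval x * weight α t x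

/-- The monic orthogonal polynomials `P_n(x,t)` with respect to `w(x,t)`, obtained from the
monomials `1, x, x², …` by orthogonalization. For `t ≥ 0`, `α > 0`, the lemmas `P_monic`,
`P_natDegree` and `P_orthogonal` below give their characteristic properties. -/
def P (α t : ℝ) (n : ℕ) : ℝ[X] :=
  X ^ n - ∑ k : Fin n, C (pairing α t (X ^ n) (P α t k) / pairing α t (P α t k) (P α t k)) * P α t k
termination_by n
decreasing_by exact k.2

/-- The squared norm `h_n(t) = ∫_{-1}^{1} P_n(x,t)² w(x,t) dx`. -/
def h (α t : ℝ) (n : ℕ) : ℝ :=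
  ∫ x in (-1 : ℝ)..1, (P α t n).eval x ^ 2 * weight α t x

/-- `R_n(t) = (2t / h_n(t)) ∫_{-1}^{1} P_n(y,t)² w(y,t) / y² dy`. -/
def R (α : ℝ) (n : ℕ) (t : ℝ) : ℝ :=
  2 * t / h α t n * ∫ y in (-1 : ℝ)..1, (P α t n).eval y ^ 2 * weight α t y / y ^ 2

/-- `S_n(t) = 1 + R_n(t) / (2n + 2α + 1)`. -/
def S (α : ℝ) (n : ℕ) (t : ℝ) : ℝ :=
  1 + R α n t / (2 * n + 2 * α + 1)

/-- `y` is a solution on the open set `U` of the fifth Painlevé equation `P_V(a, b, c, d)`,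
`y'' = (1/(2y) + 1/(y-1)) y'² - y'/t + ((y-1)²/t²)(a y + b/y) + c y/t + d y(y+1)/(y-1)`:
the right-hand side is defined along `y`, `y` is twice differentiable, the equation holds. -/
def IsPainleveVSolution (a b c d : ℝ) (U : Set ℝ) (y : ℝ → ℝ) : Prop :=
  ∀ t ∈ U, t ≠ 0 ∧ y t ≠ 0 ∧ y t ≠ 1 ∧
    DifferentiableAt ℝ y t ∧ DifferentiableAt ℝ (deriv y) t ∧
    deriv (deriv y) t =
      (1 / (2 * y t) + 1 / (y t - 1)) * deriv y t ^ 2 - deriv y t / t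
        + (y t - 1) ^ 2 / t ^ 2 * (a * y t + b / y t)
        + c * y t / t + d * y t * (y t + 1) / (y t - 1)

theorem weight_pos {α t x : ℝ} (hx : x ∈ Set.Ioo (-1 : ℝ) 1) : 0 < weight α t x := by
  have : 0 < 1 - x ^ 2 := by nlinarith [hx.1, hx.2]
  exact mul_pos (Real.rpow_pos_of_pos this _) (Real.exp_pos _)

theorem integrable_poly_mul_weight {α t : ℝ} (hα : 0 < α) (ht : 0 ≤ t) (p : ℝ[X]) :
    IntervalIntegrable (fun x => p.eval x * weight α t x) MeasureTheory.volume (-1) 1 := by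
  have hp : IntervalIntegrable (fun x => |p.eval x|) MeasureTheory.volume (-1) 1 :=
    p.continuous.abs.intervalIntegrable _ _
  refine hp.mono_fun' ?_ ?_
  · refine Measurable.aestronglyMeasurable ?_
    have := p.continuous.measurable
    unfold weight
    fun_prop
  · refine (MeasureTheory.ae_restrict_iff' measurableSet_uIoc).2 (Filter.Eventually.of_forall ?_)
    intro x hx
    rw [Set.uIoc_of_le (by norm_num)] at hx
    have h0 : 0 ≤ 1 - x ^ 2 := by nlinarith [hx.1, hx.2]
    have h1 : (1 - x ^ 2) ^ α ≤ 1 := Real.rpow_le_one h0 (by nlinarith [sq_nonneg x]) hα.le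
    have h2 : Real.exp (-t / x ^ 2) ≤ 1 := by
      rw [Real.exp_le_one_iff, neg_div]
      exact neg_nonpos.2 (by positivity)
    have h3 : |weight α t x| ≤ 1 := by
      unfold weight
      rw [abs_of_nonneg (mul_nonneg (Real.rpow_nonneg h0 _) (Real.exp_pos _).le)]
      exact mul_le_one₀ h1 (Real.exp_pos _).le h2
    change ‖p.eval x * weight α t x‖ ≤ |p.eval x|
    rw [Real.norm_eq_abs, abs_mul]
    exact mul_le_of_le_one_right (abs_nonneg _) h3

theorem pairing_self_pos {α t : ℝ} (hα : 0 < α) (ht : 0 ≤ t) {p : ℝ[X]} (hp : p ≠ 0) :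
    0 < pairing α t p p := by
  have hi : IntervalIntegrable (fun x => p.eval x * p.eval x * weight α t x)
      MeasureTheory.volume (-1) 1 := by
    simpa [eval_mul] using integrable_poly_mul_weight hα ht (p * p)
  have hnn : ∀ x ∈ Set.Ioo (-1 : ℝ) 1, 0 ≤ p.eval x * p.eval x * weight α t x :=
    fun x hx => mul_nonneg (mul_self_nonneg _) (weight_pos hx).le
  unfold pairing
  rw [intervalIntegral.integral_of_le (by norm_num), MeasureTheory.integral_Ioc_eq_integral_Ioo,
    MeasureTheory.setIntegral_pos_iff_support_of_nonneg_ae]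
  · have hsub : Set.Ioo (-1 : ℝ) 1 \ (p.roots.toFinset : Set ℝ) ⊆
        (Function.support fun x => p.eval x * p.eval x * weight α t x) ∩ Set.Ioo (-1) 1 := by
      intro x hx
      have hr : p.eval x ≠ 0 := fun h0 => hx.2 (by simp [hp, h0])
      exact ⟨mul_ne_zero (mul_ne_zero hr hr) (weight_pos hx.1).ne', hx.1⟩
    refine lt_of_lt_of_le ?_ (MeasureTheory.measure_mono hsub)
    rw [MeasureTheory.measure_sdiff_null (p.roots.toFinset.finite_toSet.measure_zero _)]
    simp
  · exact (MeasureTheory.ae_restrict_iff' measurableSet_Ioo).2 (Filter.Eventually.of_forall hnn)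
  · exact ((intervalIntegrable_iff_integrableOn_Ioo_of_le (by norm_num)).1 hi)

theorem pairing_comm (α t : ℝ) (p q : ℝ[X]) : pairing α t p q = pairing α t q p := by
  simp only [pairing, mul_comm (eval _ p)]

theorem P_monic_natDegree (α t : ℝ) (n : ℕ) : (P α t n).Monic ∧ (P α t n).natDegree = n := by
  induction n using Nat.strong_induction_on with
  | _ n ih =>
    have hdeg : (∑ k : Fin n, C (pairing α t (X ^ n) (P α t k) /
        pairing α t (P α t k) (P α t k)) * P α t k).degree < n := by
      refine (degree_sum_le _ _).trans_lt ((Finset.sup_lt_iff (WithBot.bot_lt_coe n)).2 ?_)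
      intro k _
      rw [← smul_eq_C_mul]
      refine (degree_smul_le _ _).trans_lt ?_
      rw [degree_eq_natDegree (ih k k.2).1.ne_zero, (ih k k.2).2]
      exact WithBot.coe_lt_coe.2 k.2
    rw [P]
    refine ⟨(monic_X_pow n).sub_of_left (by rwa [degree_X_pow]), ?_⟩
    apply natDegree_eq_of_degree_eq_some
    rw [degree_sub_eq_left_of_degree_lt (by rwa [degree_X_pow]), degree_X_pow]

/-- `P_n` is monic. -/
theorem P_monic (α t : ℝ) (n : ℕ) : (P α t n).Monic := (P_monic_natDegree α t n).1

/-- `P_n` has degree `n`. -/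
theorem P_natDegree (α t : ℝ) (n : ℕ) : (P α t n).natDegree = n := (P_monic_natDegree α t n).2

theorem pairing_P_of_lt {α t : ℝ} (hα : 0 < α) (ht : 0 ≤ t) (n : ℕ) :
    ∀ j < n, pairing α t (P α t n) (P α t j) = 0 := by
  induction n using Nat.strong_induction_on with
  | _ n ih =>
    intro j hj
    have horth : ∀ k < n, k ≠ j → pairing α t (P α t k) (P α t j) = 0 := by
      intro k hk hkj
      rcases lt_or_gt_of_ne hkj with h | h
      · rw [pairing_comm]; exact ih j hj k h
      · exact ih k hk j h
    have hint : ∀ q r : ℝ[X], IntervalIntegrable (fun x => q.eval x * r.eval x * weight α t x)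
        MeasureTheory.volume (-1) 1 := fun q r => by
      simpa [eval_mul] using integrable_poly_mul_weight hα ht (q * r)
    have key : pairing α t (P α t n) (P α t j) = pairing α t (X ^ n) (P α t j) -
        ∑ k : Fin n, pairing α t (X ^ n) (P α t k) / pairing α t (P α t k) (P α t k) *
          pairing α t (P α t k) (P α t j) := by
      conv_lhs => rw [P]
      simp only [pairing]
      simp_rw [← intervalIntegral.integral_const_mul]
      rw [← intervalIntegral.integral_finsetSum
        (fun k _ => (hint _ _).const_mul _), ← intervalIntegral.integral_sub (hint _ _)]
      · congr 1
        ext x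
        simp only [eval_sub, eval_finsetSum, eval_mul, eval_C, sub_mul, Finset.sum_mul]
        congr 1
        exact Finset.sum_congr rfl fun k _ => by ring
      · have := IntervalIntegrable.sum (Finset.univ : Finset (Fin n)) fun k _ =>
          (hint (P α t k) (P α t j)).const_mul
            (pairing α t (X ^ n) (P α t k) / pairing α t (P α t k) (P α t k))
        refine this.congr (fun x _ => ?_)
        simp [pairing]
    rw [key, Finset.sum_eq_single (⟨j, hj⟩ : Fin n), div_mul_cancel₀, sub_self]
    · exact (pairing_self_pos hα ht (P_monic α t j).ne_zero).ne'
    · intro k _ hk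
      rw [horth k k.2 (fun h => hk (Fin.ext h)), mul_zero]
    · simp

/-- The polynomials `P_0, P_1, …` are pairwise orthogonal with respect to `w(x,t) dx`. -/
theorem P_orthogonal {α t : ℝ} (hα : 0 < α) (ht : 0 ≤ t) {j k : ℕ} (hjk : j ≠ k) :
    ∫ x in (-1 : ℝ)..1, (P α t j).eval x * (P α t k).eval x * weight α t x = 0 := by
  change pairing α t _ _ = 0
  rcases lt_or_gt_of_ne hjk with h | h
  · rw [pairing_comm]; exact pairing_P_of_lt hα ht k j h
  · exact pairing_P_of_lt hα ht j k h

/-- The squared norms `h_n(t)` are positive. -/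
theorem h_pos {α t : ℝ} (hα : 0 < α) (ht : 0 ≤ t) (n : ℕ) : 0 < h α t n := by
  have := pairing_self_pos hα ht (P_monic α t n).ne_zero
  simpa only [pairing, h, sq] using this

end SingularJacobi

end

/-! ### Moments of the weight -/

open Polynomial
noncomputable section
namespace SingularJacobi

/-! Write a = 2n+2α+1, σ = (-1)^n, β = h_{n+1}/h_n, and r_n for `auxR`. Since e^{-t/x²} beats every
power of x at 0, all integrals ∫ p x^{-k} w are finite, and ∂_t w = -w/x² lets them be
differentiated in t.

Two polynomial identities carry the proof. `Pdot_ladder` expresses x² ∂_t P_n through P_n and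
P_{n+1}. `dilation_ladder` does the same for x(1-x²) ∂_x P_n + 2t ∂_t P_n. This vector field is
natural: x ∂_x + 2t ∂_t leaves t/x² invariant, and the factor 1-x² removes the singularities at ±1,
so applied to log w the field gives the polynomial -2αx² - 2t. Both identities are proved by testing
the difference of the two sides against every P_j.

Algebraic relations between neighbouring indices follow: r_n + r_{n+1} = R_n by definition, β R_n
R_{n+1} = 2tσ r_{n+1} from the pole at 0 (`R_mul_R_succ`), and, from the ladders at x = 1, β
(a+2+R_{n+1})(a+R_n) = (r_{n+1}+n+1)(r_{n+1}+n+1+2α) (`add_R_mul_add_R_succ`).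

Integrating the dilation ladder against P_n w/x² gives a first-order equation for R_n
(`hasDerivAt_R`). Differentiating r_{n+1} = σ β R_n R_{n+1}/(2t) and eliminating β and R_n gives one
for r_{n+1} (`hasDerivAt_auxR`). Hence (R_n, r_n) solves a closed first-order system at fixed n, and
eliminating r_n gives (i). Equation (ii) is (i) under R = a(S-1); R > 0 gives S > 1. -/

/-- The moments `∫ x^j w(x,t) dx`, `j ∈ ℤ`. -/
def moment (α t : ℝ) (j : ℤ) : ℝ := ∫ x in (-1 : ℝ)..1, x ^ j * weight α t x

/-- For negative exponents this is u^m/m! ≤ e^u at u = t/x², combined with |x|^{-m} ≤ (x^{-2})^m for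
|x| ≤ 1. -/
theorem exists_bound_zpow_mul_exp {t : ℝ} (ht : 0 < t) (j : ℤ) :
    ∃ K : ℝ, ∀ x : ℝ, x ≠ 0 → |x| ≤ 1 → |x| ^ j * Real.exp (-t / x ^ 2) ≤ K := by
  obtain ⟨m, hm | hm⟩ := j.eq_nat_or_neg
  · refine ⟨1, fun x _ hx1 => ?_⟩
    subst hm
    refine mul_le_one₀ ?_ (Real.exp_pos _).le ?_
    · rw [zpow_natCast]; exact pow_le_one₀ (abs_nonneg x) hx1
    · rw [Real.exp_le_one_iff, neg_div]
      exact neg_nonpos.2 (by positivity)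
  · refine ⟨m.factorial / t ^ m, fun x hx0 hx1 => ?_⟩
    subst hm
    have hx : 0 < |x| := abs_pos.2 hx0
    have h1 := Real.pow_div_factorial_le_exp (t / x ^ 2) (by positivity) m
    have h2 : |x| ^ (-(m : ℤ)) ≤ (1 / x ^ 2) ^ m := by
      rw [zpow_neg, zpow_natCast, one_div, inv_pow, ← sq_abs, ← pow_mul]
      refine inv_anti₀ (by positivity) ?_
      exact pow_le_pow_of_le_one hx.le hx1 (by omega)
    calc |x| ^ (-(m : ℤ)) * Real.exp (-t / x ^ 2)
        ≤ (1 / x ^ 2) ^ m * Real.exp (-t / x ^ 2) := by gcongr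
      _ = (m.factorial / t ^ m) * ((t / x ^ 2) ^ m / m.factorial * Real.exp (-t / x ^ 2)) := by
          simp only [div_pow, one_pow]; field_simp
      _ ≤ (m.factorial / t ^ m) * (Real.exp (t / x ^ 2) * Real.exp (-t / x ^ 2)) := by gcongr
      _ = m.factorial / t ^ m := by
          rw [← Real.exp_add, neg_div, add_neg_cancel, Real.exp_zero, mul_one]

theorem weight_nonneg {α t x : ℝ} (hx : |x| ≤ 1) : 0 ≤ weight α t x := by
  have := (sq_le_one_iff_abs_le_one x).2 hx
  exact mul_nonneg (Real.rpow_nonneg (by linarith) _) (Real.exp_pos _).le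

theorem exists_bound_zpow_mul_weight {α t : ℝ} (hα : 0 ≤ α) (ht : 0 < t) (j : ℤ) :
    ∃ K : ℝ, ∀ x : ℝ, x ≠ 0 → |x| ≤ 1 → |x ^ j * weight α t x| ≤ K := by
  obtain ⟨K, hK⟩ := exists_bound_zpow_mul_exp ht j
  refine ⟨K, fun x hx0 hx1 => le_trans ?_ (hK x hx0 hx1)⟩
  have h2 := (sq_le_one_iff_abs_le_one x).2 hx1
  rw [abs_mul, abs_zpow, abs_of_nonneg (weight_nonneg hx1)]
  refine mul_le_mul_of_nonneg_left ?_ (by positivity)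
  exact mul_le_of_le_one_left (Real.exp_pos _).le
    (Real.rpow_le_one (by linarith) (by nlinarith [sq_nonneg x]) hα)

theorem measurable_zpow_mul_weight (α t : ℝ) (j : ℤ) :
    Measurable fun x : ℝ => x ^ j * weight α t x := by
  unfold weight
  fun_prop

theorem ae_ne_zero_restrict (s : Set ℝ) :
    ∀ᵐ x ∂(MeasureTheory.volume.restrict s), x ≠ (0 : ℝ) :=
  MeasureTheory.ae_restrict_of_ae (MeasureTheory.Measure.ae_ne MeasureTheory.volume 0)

theorem abs_le_one_of_mem_uIoc {x : ℝ} (hx : x ∈ Set.uIoc (-1 : ℝ) 1) : |x| ≤ 1 := by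
  rw [Set.uIoc_of_le (by norm_num)] at hx
  exact abs_le.2 ⟨hx.1.le, hx.2⟩

theorem intervalIntegrable_zpow_mul_weight {α t : ℝ} (hα : 0 ≤ α) (ht : 0 < t) (j : ℤ) :
    IntervalIntegrable (fun x : ℝ => x ^ j * weight α t x) MeasureTheory.volume (-1) 1 := by
  obtain ⟨K, hK⟩ := exists_bound_zpow_mul_weight hα ht j
  refine (intervalIntegrable_const (c := K)).mono_fun'
    (measurable_zpow_mul_weight α t j).aestronglyMeasurable ?_
  filter_upwards [ae_ne_zero_restrict _, MeasureTheory.ae_restrict_mem measurableSet_uIoc]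
    with x hx0 hx
  exact hK x hx0 (abs_le_one_of_mem_uIoc hx)

theorem moment_eq_zero_of_odd (α t : ℝ) {j : ℤ} (hj : Odd j) : moment α t j = 0 := by
  have h := intervalIntegral.integral_comp_neg (a := -1) (b := 1)
    fun x : ℝ => x ^ j * weight α t x
  have h2 : ∀ x : ℝ, (-x) ^ j * weight α t (-x) = -(x ^ j * weight α t x) := fun x => by
    simp [weight, hj.neg_zpow]
  simp only [h2, intervalIntegral.integral_neg, neg_neg] at h
  unfold moment
  linarith

/-- Differentiation under the integral: the weight decreases in s, so for s > t/2 the weight at t/2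
dominates. -/
theorem hasDerivAt_moment {α t : ℝ} (hα : 0 ≤ α) (ht : 0 < t) (j : ℤ) :
    HasDerivAt (fun s => moment α s j) (-moment α t (j - 2)) t := by
  have key := intervalIntegral.hasDerivAt_integral_of_dominated_loc_of_deriv_le
    (μ := MeasureTheory.volume) (a := -1) (b := 1) (x₀ := t) (s := Set.Ioi (t / 2))
    (F := fun s x => x ^ j * weight α s x)
    (F' := fun s x => -(x ^ (j - 2) * weight α s x))
    (bound := fun x => |x ^ (j - 2) * weight α (t / 2) x|)
    (Ioi_mem_nhds (by linarith))
    (Filter.Eventually.of_forall fun s => (measurable_zpow_mul_weight α s j).aestronglyMeasurable)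
    (intervalIntegrable_zpow_mul_weight hα ht j)
    (measurable_zpow_mul_weight α t (j - 2)).neg.aestronglyMeasurable
    ?_ (intervalIntegrable_zpow_mul_weight hα (by linarith) (j - 2)).abs ?_
  · have := key.2
    simpa only [intervalIntegral.integral_neg, moment] using this
  · refine Filter.Eventually.of_forall fun x hx s hs => ?_
    have hx1 := abs_le_one_of_mem_uIoc hx
    rw [norm_neg, Real.norm_eq_abs, abs_mul, abs_mul, abs_of_nonneg (weight_nonneg hx1),
      abs_of_nonneg (weight_nonneg hx1)]
    refine mul_le_mul_of_nonneg_left ?_ (abs_nonneg _)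
    have h2 := (sq_le_one_iff_abs_le_one x).2 hx1
    refine mul_le_mul_of_nonneg_left (Real.exp_le_exp.2 ?_) (Real.rpow_nonneg (by linarith) _)
    have : t / 2 < s := hs
    gcongr
  · filter_upwards [MeasureTheory.Measure.ae_ne MeasureTheory.volume (0 : ℝ)] with x hx0 _ s _
    have h1 : HasDerivAt (fun s : ℝ => -s / x ^ 2) (-1 / x ^ 2) s :=
      (hasDerivAt_neg s).div_const _
    have h2 := (h1.exp.const_mul ((1 - x ^ 2) ^ α)).const_mul (x ^ j)
    refine h2.congr_deriv ?_
    rw [zpow_sub₀ hx0, weight]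
    field_simp

theorem tendsto_zpow_mul_weight_zero {α t : ℝ} (hα : 0 ≤ α) (ht : 0 < t) (j : ℤ) :
    Filter.Tendsto (fun x : ℝ => x ^ j * weight α t x) (nhdsWithin 0 {0}ᶜ) (nhds 0) := by
  obtain ⟨K, hK⟩ := exists_bound_zpow_mul_weight hα ht (j - 1)
  have h1 : Filter.Tendsto (fun x : ℝ => K * |x|) (nhdsWithin 0 {0}ᶜ) (nhds 0) := by
    have : Continuous fun x : ℝ => K * |x| := by fun_prop
    simpa using (this.tendsto 0).mono_left nhdsWithin_le_nhds
  refine squeeze_zero_norm' ?_ h1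
  have h3 : ∀ᶠ x in nhdsWithin (0 : ℝ) {0}ᶜ, |x| ≤ 1 := by
    refine nhdsWithin_le_nhds ?_
    filter_upwards [Metric.closedBall_mem_nhds (0 : ℝ) one_pos] with x hx
    simpa using hx
  filter_upwards [h3, self_mem_nhdsWithin] with x hx1 hx0
  have hx0' : x ≠ 0 := hx0
  have h4 : x ^ j * weight α t x = (x ^ (j - 1) * weight α t x) * x := by
    rw [mul_right_comm, zpow_sub_one₀ hx0', inv_mul_cancel_right₀ hx0']
  rw [Real.norm_eq_abs, h4, abs_mul]
  exact mul_le_mul_of_nonneg_right (hK x hx0' hx1) (abs_nonneg _)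

/-- The factor 1-x² cancels the 1/(1-x²) produced by differentiating (1-x²)^α, so only powers of x
times the weight remain. -/
theorem hasDerivAt_zpow_mul_weight {α t x : ℝ} (hx0 : x ≠ 0) (hx : |x| < 1) (j : ℤ) :
    HasDerivAt (fun x : ℝ => x ^ j * (1 - x ^ 2) * weight α t x)
      (j * (x ^ (j - 1) * weight α t x) - (j + 2 + 2 * α) * (x ^ (j + 1) * weight α t x)
        + 2 * t * (x ^ (j - 3) * weight α t x) - 2 * t * (x ^ (j - 1) * weight α t x)) x := by
  have h2 := (sq_lt_one_iff_abs_lt_one x).2 hx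
  have h3 : (1 - x ^ 2 : ℝ) ≠ 0 := by linarith
  have d1 : HasDerivAt (fun x : ℝ => 1 - x ^ 2) (-(2 * x)) x := by
    simpa using (hasDerivAt_pow 2 x).const_sub 1
  have d2 := d1.rpow_const (p := α) (Or.inl h3)
  have d3 : HasDerivAt (fun x : ℝ => -t / x ^ 2) (2 * t / x ^ 3) x := by
    have := (hasDerivAt_const x (-t)).fun_div (hasDerivAt_pow 2 x) (pow_ne_zero 2 hx0)
    refine this.congr_deriv ?_
    push_cast
    field_simp
    ring
  have d4 := ((hasDerivAt_zpow j x (Or.inl hx0)).mul d1).mul (d2.mul d3.exp)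
  refine d4.congr_deriv ?_
  have e1 : x ^ j = x ^ (j - 3) * x ^ 3 := by
    rw [← zpow_natCast, ← zpow_add₀ hx0]; congr 1; norm_num
  have e2 : x ^ (j - 1) = x ^ (j - 3) * x ^ 2 := by
    rw [← zpow_natCast, ← zpow_add₀ hx0]; congr 1; norm_num; ring
  have e3 : x ^ (j + 1) = x ^ (j - 3) * x ^ 4 := by
    rw [← zpow_natCast, ← zpow_add₀ hx0]; congr 1; norm_num; ring
  rw [e1, e2, e3, Real.rpow_sub_one h3]
  simp only [Pi.mul_apply, weight]
  generalize (1 - x ^ 2) ^ α = W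
  generalize Real.exp (-t / x ^ 2) = Ex
  generalize x ^ (j - 3) = Z at e1
  simp only [e1]
  field_simp
  ring

theorem moment_recurrence {α t : ℝ} (hα : 0 < α) (ht : 0 < t) (j : ℤ) :
    j * moment α t (j - 1) - (j + 2 + 2 * α) * moment α t (j + 1)
      + 2 * t * moment α t (j - 3) - 2 * t * moment α t (j - 1) = 0 := by
  have hi := fun i => intervalIntegrable_zpow_mul_weight hα.le ht i
  have hint := (((hi (j - 1)).const_mul (j : ℝ)).sub ((hi (j + 1)).const_mul (j + 2 + 2 * α))).add
    ((hi (j - 3)).const_mul (2 * t)) |>.sub ((hi (j - 1)).const_mul (2 * t))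
  have hcont : ∀ x : ℝ, x ≠ 0 →
      ContinuousAt (fun x : ℝ => x ^ j * (1 - x ^ 2) * weight α t x) x := fun x hx => by
    unfold weight
    refine (ContinuousAt.mul (ContinuousAt.zpow₀ continuousAt_id _ (Or.inl hx)) (by fun_prop)).mul
      (ContinuousAt.mul ?_ ?_)
    · exact ContinuousAt.rpow_const (by fun_prop) (Or.inr hα.le)
    · have : x ^ 2 ≠ 0 := pow_ne_zero 2 hx
      fun_prop (disch := assumption)
  have h0 : Filter.Tendsto (fun x : ℝ => x ^ j * (1 - x ^ 2) * weight α t x)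
      (nhdsWithin 0 {0}ᶜ) (nhds 0) := by
    have h1 := tendsto_zpow_mul_weight_zero hα.le ht j
    have h2 : Filter.Tendsto (fun x : ℝ => 1 - x ^ 2) (nhdsWithin 0 {0}ᶜ) (nhds 1) := by
      have : Continuous fun x : ℝ => 1 - x ^ 2 := by fun_prop
      simpa using (this.tendsto 0).mono_left nhdsWithin_le_nhds
    simpa [mul_assoc, mul_left_comm] using h2.mul h1
  have hs1 : Set.uIcc (-1 : ℝ) 0 ⊆ Set.uIcc (-1) 1 := by
    rw [Set.uIcc_of_le (by norm_num), Set.uIcc_of_le (by norm_num)]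
    exact Set.Icc_subset_Icc le_rfl (by norm_num)
  have hs2 : Set.uIcc (0 : ℝ) 1 ⊆ Set.uIcc (-1) 1 := by
    rw [Set.uIcc_of_le (by norm_num), Set.uIcc_of_le (by norm_num)]
    exact Set.Icc_subset_Icc (by norm_num) le_rfl
  -- The interval is split at 0 because the formal values there (division by zero) are meaningless;
  -- only the limit, which is 0, enters. At ±1 the factor 1-x² vanishes.
  have left := intervalIntegral.integral_eq_sub_of_hasDerivAt_of_tendsto (a := -1) (b := 0)
    (by norm_num)
    (fun x hx => hasDerivAt_zpow_mul_weight (α := α) (t := t) hx.2.ne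
      (abs_lt.2 ⟨hx.1, hx.2.trans one_pos⟩) j)
    (hint.mono_set hs1)
    ((hcont (-1) (by norm_num)).tendsto.mono_left nhdsWithin_le_nhds)
    (h0.mono_left (nhdsWithin_mono _ fun x (hx : x < 0) => hx.ne))
  have right := intervalIntegral.integral_eq_sub_of_hasDerivAt_of_tendsto (a := 0) (b := 1)
    (by norm_num)
    (fun x hx => hasDerivAt_zpow_mul_weight (α := α) (t := t) hx.1.ne'
      (abs_lt.2 ⟨by linarith [hx.1], hx.2⟩) j)
    (hint.mono_set hs2)
    (h0.mono_left (nhdsWithin_mono _ fun x (hx : 0 < x) => hx.ne'))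
    ((hcont 1 (by norm_num)).tendsto.mono_left nhdsWithin_le_nhds)
  have total := intervalIntegral.integral_add_adjacent_intervals
    (hint.mono_set hs1) (hint.mono_set hs2)
  have e : ∫ x in (-1 : ℝ)..1, (j * (x ^ (j - 1) * weight α t x)
      - (j + 2 + 2 * α) * (x ^ (j + 1) * weight α t x)
        + 2 * t * (x ^ (j - 3) * weight α t x) - 2 * t * (x ^ (j - 1) * weight α t x)) =
      j * moment α t (j - 1) - (j + 2 + 2 * α) * moment α t (j + 1)
      + 2 * t * moment α t (j - 3) - 2 * t * moment α t (j - 1) := by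
    rw [intervalIntegral.integral_sub, intervalIntegral.integral_add,
      intervalIntegral.integral_sub]
    · simp only [intervalIntegral.integral_const_mul, moment]
    · exact (hi _).const_mul _
    · exact (hi _).const_mul _
    · exact ((hi _).const_mul _).sub ((hi _).const_mul _)
    · exact (hi _).const_mul _
    · exact (((hi _).const_mul _).sub ((hi _).const_mul _)).add ((hi _).const_mul _)
    · exact (hi _).const_mul _
  rw [← e]
  refine total.symm.trans ?_
  rw [left, right]
  norm_num

end SingularJacobi
end
-- The functionals ∫ p x^{-k} w, and parity
open Polynomial
noncomputable section
namespace SingularJacobi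

/-- The linear functional `p ↦ ∫ p(x) x^{-k} w(x,t) dx` on polynomials. -/
def J (α t : ℝ) (k : ℕ) : ℝ[X] →ₗ[ℝ] ℝ :=
  Polynomial.lsum fun i => moment α t ((i : ℤ) - k) • LinearMap.id

theorem J_monomial (α t : ℝ) (k i : ℕ) (c : ℝ) :
    J α t k (monomial i c) = moment α t ((i : ℤ) - k) * c := by
  simp [J, Polynomial.lsum_apply, sum_monomial_index]

theorem J_eq_sum (α t : ℝ) (k : ℕ) (p : ℝ[X]) {N : ℕ} (hN : p.natDegree ≤ N) :
    J α t k p = ∑ i ∈ Finset.range (N + 1), p.coeff i * moment α t ((i : ℤ) - k) := by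
  conv_lhs => rw [p.as_sum_range' (N + 1) (by omega)]
  simp [J_monomial, mul_comm]

theorem J_C_mul (α t : ℝ) (k : ℕ) (c : ℝ) (p : ℝ[X]) : J α t k (C c * p) = c * J α t k p := by
  rw [← smul_eq_C_mul, map_smul, smul_eq_mul]

theorem J_X_mul (α t : ℝ) (k : ℕ) (p : ℝ[X]) : J α t (k + 1) (X * p) = J α t k p := by
  induction p using Polynomial.induction_on' with
  | add p q hp hq => rw [mul_add, map_add, map_add, hp, hq]
  | monomial i c =>
    rw [X_mul_monomial, J_monomial, J_monomial]
    congr 2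
    push_cast
    ring

theorem J_X_pow_mul (α t : ℝ) (k m : ℕ) (p : ℝ[X]) :
    J α t (k + m) (X ^ m * p) = J α t k p := by
  induction m with
  | zero => simp
  | succ m ih => rw [pow_succ', mul_assoc, ← add_assoc, J_X_mul, ih]

theorem J_eq_integral {α t : ℝ} (hα : 0 ≤ α) (ht : 0 < t) (k : ℕ) (p : ℝ[X]) :
    IntervalIntegrable (fun x => p.eval x / x ^ k * weight α t x) MeasureTheory.volume (-1) 1 ∧
    J α t k p = ∫ x in (-1 : ℝ)..1, p.eval x / x ^ k * weight α t x := by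
  induction p using Polynomial.induction_on' with
  | add p q hp hq =>
    simp only [eval_add, add_div, add_mul]
    refine ⟨hp.1.add hq.1, ?_⟩
    rw [intervalIntegral.integral_add hp.1 hq.1, map_add, hp.2, hq.2]
  | monomial i c =>
    have hi := (intervalIntegrable_zpow_mul_weight hα ht ((i : ℤ) - k)).mul_const c
    have he : ∀ x : ℝ, x ≠ 0 → x ^ ((i : ℤ) - k) * weight α t x * c =
        (monomial i c).eval x / x ^ k * weight α t x := fun x hx => by
      rw [zpow_sub₀ hx, eval_monomial, zpow_natCast, zpow_natCast]
      ring
    constructor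
    · refine hi.congr_ae ?_
      filter_upwards [ae_ne_zero_restrict _] with x hx using he x hx
    · rw [J_monomial, moment, ← intervalIntegral.integral_mul_const]
      refine intervalIntegral.integral_congr_ae ?_
      filter_upwards [MeasureTheory.Measure.ae_ne MeasureTheory.volume (0 : ℝ)] with x hx _
        using he x hx

/-- Linear extension of `moment_recurrence`: the total derivative of x^{-k}(1-x²) p w integrates to
zero. -/
theorem J_integration_by_parts {α t : ℝ} (hα : 0 < α) (ht : 0 < t) (k : ℕ) (p : ℝ[X]) :
    J α t (k + 1) (X * (1 - X ^ 2) * derivative p) - k * J α t (k + 1) ((1 - X ^ 2) * p)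
      - (2 + 2 * α) * J α t k (X * p) + 2 * t * J α t (k + 3) ((1 - X ^ 2) * p) = 0 := by
  induction p using Polynomial.induction_on' with
  | add p q hp hq =>
    simp only [mul_add, map_add]
    linarith
  | monomial i c =>
    have hX : X * derivative (monomial i c) = monomial i ((i : ℝ) * c) := by
      rw [derivative_monomial]
      rcases i with _ | i
      · simp
      · rw [X_mul_monomial]; simp [mul_comm]
    rw [mul_right_comm, hX, mul_sub, mul_one, sub_mul, one_mul, X_mul_monomial]
    simp only [X_pow_mul, monomial_mul_X_pow]
    simp only [map_sub, J_monomial]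
    have key := moment_recurrence hα ht ((i : ℤ) - k)
    push_cast at key ⊢
    have e1 : (i : ℤ) - (k + 1) = i - k - 1 := by ring
    have e2 : (i : ℤ) + 2 - (k + 1) = i - k + 1 := by ring
    have e3 : (i : ℤ) - (k + 3) = i - k - 3 := by ring
    have e4 : (i : ℤ) + 2 - (k + 3) = i - k - 1 := by ring
    have e5 : (i : ℤ) + 1 - k = i - k + 1 := by ring
    rw [e1, e2, e3, e4, e5]
    linear_combination c * key

/-- `p(-x) = (-1)^n p(x)`, expressed through the coefficients of `p`. -/
def HasParity (n : ℕ) (p : ℝ[X]) : Prop := ∀ i, Odd (i + n) → p.coeff i = 0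

namespace HasParity
variable {n m : ℕ} {p q : ℝ[X]}

theorem add (hp : HasParity n p) (hq : HasParity n q) : HasParity n (p + q) := fun i hi => by
  rw [coeff_add, hp i hi, hq i hi, add_zero]

theorem sub (hp : HasParity n p) (hq : HasParity n q) : HasParity n (p - q) := fun i hi => by
  rw [coeff_sub, hp i hi, hq i hi, sub_zero]

theorem C_mul (hp : HasParity n p) (c : ℝ) : HasParity n (C c * p) := fun i hi => by
  rw [coeff_C_mul, hp i hi, mul_zero]

theorem mul (hp : HasParity n p) (hq : HasParity m q) : HasParity (n + m) (p * q) := fun i hi => by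
  rw [coeff_mul]
  refine Finset.sum_eq_zero fun x hx => ?_
  rw [Finset.HasAntidiagonal.mem_antidiagonal] at hx
  rcases Nat.even_or_odd (x.1 + n) with h1 | h1
  · rw [hq, mul_zero]
    rw [← hx] at hi
    rw [Nat.odd_iff] at hi ⊢
    rw [Nat.even_iff] at h1
    omega
  · rw [hp _ h1, zero_mul]

theorem X_pow (n : ℕ) : HasParity n (X ^ n) := fun i hi => by
  rw [coeff_X_pow, if_neg]
  rintro rfl
  exact (Nat.not_odd_iff_even.2 ⟨i, rfl⟩) hi

theorem congr (hp : HasParity n p) (h : Even (n + m)) : HasParity m p := fun i hi => hp i (by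
  rw [Nat.odd_iff] at hi ⊢
  rw [Nat.even_iff] at h
  omega)

theorem derivative (hp : HasParity n p) : HasParity (n + 1) (derivative p) := fun i hi => by
  rw [coeff_derivative, hp, zero_mul]
  rwa [add_assoc, add_comm 1 n]

theorem sum {ι : Type*} {s : Finset ι} {f : ι → ℝ[X]} (h : ∀ i ∈ s, HasParity n (f i)) :
    HasParity n (∑ i ∈ s, f i) := fun i hi => by
  rw [finsetSum_coeff]
  exact Finset.sum_eq_zero fun k hk => h k hk i hi

end HasParity

theorem J_eq_zero_of_parity (α t : ℝ) {k n : ℕ} {p : ℝ[X]} (hp : HasParity n p)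
    (h : Odd (n + k)) : J α t k p = 0 := by
  rw [J_eq_sum α t k p le_rfl]
  refine Finset.sum_eq_zero fun i _ => ?_
  rcases Nat.even_or_odd (i + n) with h1 | h1
  · rw [moment_eq_zero_of_odd, mul_zero]
    rw [Nat.odd_iff] at h
    rw [Nat.even_iff] at h1
    rw [Int.odd_iff]
    omega
  · rw [hp i h1, zero_mul]

/-! ### Orthogonality in terms of `J` -/

section Orthogonality
variable {α t : ℝ}

theorem pairing_eq_J (hα : 0 ≤ α) (ht : 0 < t) (p q : ℝ[X]) :
    pairing α t p q = J α t 0 (p * q) := by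
  rw [(J_eq_integral hα ht 0 (p * q)).2, pairing]
  simp

theorem h_eq_J (hα : 0 ≤ α) (ht : 0 < t) (n : ℕ) :
    h α t n = J α t 0 (P α t n * P α t n) := by
  rw [← pairing_eq_J hα ht, h, pairing]
  simp only [sq]

theorem R_eq_J (hα : 0 ≤ α) (ht : 0 < t) (n : ℕ) :
    R α n t = 2 * t / h α t n * J α t 2 (P α t n * P α t n) := by
  rw [(J_eq_integral hα ht 2 _).2, R]
  congr 2
  ext x
  rw [eval_mul]
  ring

/-- On [-1,1] one has 1/x² ≥ 1, so the integral dominates the squared norm of p. -/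
theorem J_two_mul_self_pos (hα : 0 < α) (ht : 0 < t) {p : ℝ[X]} (hp : p ≠ 0) :
    0 < J α t 2 (p * p) := by
  refine (pairing_self_pos hα ht.le hp).trans_le ?_
  rw [pairing_eq_J hα.le ht, (J_eq_integral hα.le ht 2 _).2, (J_eq_integral hα.le ht 0 _).2]
  refine intervalIntegral.integral_mono_ae_restrict (by norm_num) (J_eq_integral hα.le ht 0 _).1
    (J_eq_integral hα.le ht 2 _).1 ?_
  filter_upwards [ae_ne_zero_restrict _, MeasureTheory.ae_restrict_mem measurableSet_Icc]
    with x hx0 hx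
  have hx1 : |x| ≤ 1 := abs_le.2 hx
  refine mul_le_mul_of_nonneg_right ?_ (weight_nonneg hx1)
  rw [eval_mul, pow_zero, div_one, le_div_iff₀ (by positivity)]
  exact mul_le_of_le_one_right (mul_self_nonneg _) ((sq_le_one_iff_abs_le_one x).2 hx1)

theorem P_hasParity (hα : 0 ≤ α) (ht : 0 < t) (n : ℕ) : HasParity n (P α t n) := by
  induction n using Nat.strong_induction_on with
  | _ n ih =>
    rw [P]
    refine (HasParity.X_pow n).sub (HasParity.sum fun k _ => ?_)
    rcases Nat.even_or_odd (n + k) with h1 | h1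
    · exact ((ih k k.2).congr (by rwa [add_comm])).C_mul _
    · rw [pairing_eq_J hα ht,
        J_eq_zero_of_parity α t ((HasParity.X_pow n).mul (ih k k.2)) (by simpa using h1)]
      simp [HasParity]

theorem P_coeff_self (α t : ℝ) (n : ℕ) : (P α t n).coeff n = 1 := by
  have := P_monic α t n
  rwa [Monic, leadingCoeff, P_natDegree] at this

theorem P_degree (α t : ℝ) (n : ℕ) : (P α t n).degree = n := by
  rw [degree_eq_natDegree (P_monic α t n).ne_zero, P_natDegree]

theorem P_zero (α t : ℝ) : P α t 0 = 1 := by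
  rw [P]; simp

theorem degree_sub_C_coeff_mul_P_lt (α t : ℝ) {f : ℝ[X]} {n : ℕ} (hf : f.degree ≤ n) :
    (f - C (f.coeff n) * P α t n).degree < n := by
  rw [degree_lt_iff_coeff_zero]
  intro m hm
  rcases hm.eq_or_lt with rfl | hm
  · simp [P_coeff_self]
  · have h1 : f.coeff m = 0 := coeff_eq_zero_of_degree_lt (hf.trans_lt (by exact_mod_cast hm))
    have h2 : (P α t n).coeff m = 0 :=
      coeff_eq_zero_of_natDegree_lt (by rwa [P_natDegree])
    simp [h1, h2]

theorem J_P_mul_eq_zero (hα : 0 < α) (ht : 0 < t) {n : ℕ} {f : ℝ[X]} (hf : f.degree < n) :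
    J α t 0 (P α t n * f) = 0 := by
  suffices ∀ N ≤ n, ∀ f : ℝ[X], f.degree < N → J α t 0 (P α t n * f) = 0 from this n le_rfl f hf
  intro N
  induction N with
  | zero =>
    intro _ f hf
    have : f = 0 := by simpa using hf
    simp [this]
  | succ N ih =>
    intro hN f hf
    have hf' : f.degree ≤ N := by
      rw [degree_lt_iff_coeff_zero] at hf
      rw [degree_le_iff_coeff_zero]
      intro m hm
      exact hf m (by exact_mod_cast hm)
    have h1 := ih (by omega) _ (degree_sub_C_coeff_mul_P_lt α t hf')
    have h2 := pairing_P_of_lt hα ht.le n N (by omega)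
    rw [pairing_eq_J hα.le ht] at h2
    rwa [mul_sub, map_sub, mul_left_comm, J_C_mul, h2, mul_zero, sub_zero] at h1

theorem J_P_mul (hα : 0 < α) (ht : 0 < t) {n : ℕ} {f : ℝ[X]} (hf : f.degree ≤ n) :
    J α t 0 (P α t n * f) = f.coeff n * h α t n := by
  have h1 := J_P_mul_eq_zero hα ht (degree_sub_C_coeff_mul_P_lt α t hf)
  rw [mul_sub, map_sub, mul_left_comm, J_C_mul, ← h_eq_J hα.le ht] at h1
  linarith

/-- Testing against P_N reads off the coefficient of x^N, so the degree bound descends. This is the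
tool behind the recurrence and both ladder identities. -/
theorem eq_zero_of_J_P_mul_eq_zero (hα : 0 < α) (ht : 0 < t) {N : ℕ} {f : ℝ[X]}
    (hf : f.natDegree ≤ N) (hJ : ∀ j ≤ N, J α t 0 (P α t j * f) = 0) : f = 0 := by
  induction N with
  | zero =>
    have h1 := hJ 0 le_rfl
    rw [J_P_mul hα ht (natDegree_le_iff_degree_le.1 hf)] at h1
    rw [eq_C_of_natDegree_le_zero hf, (mul_eq_zero.1 h1).resolve_right (h_pos hα ht.le 0).ne', C_0]
  | succ N ih =>
    have h1 := hJ (N + 1) le_rfl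
    rw [J_P_mul hα ht (natDegree_le_iff_degree_le.1 hf)] at h1
    have h2 := (mul_eq_zero.1 h1).resolve_right (h_pos hα ht.le (N + 1)).ne'
    refine ih ?_ fun j hj => hJ j (by omega)
    rw [natDegree_le_iff_coeff_eq_zero] at hf ⊢
    intro m hm
    rcases (Nat.succ_le_of_lt hm).eq_or_lt with rfl | hm
    · exact h2
    · exact hf m hm

end Orthogonality

/-! ### Differentiation with respect to t -/

/-- A family of polynomials of bounded degree, differentiable in the parameter. -/
def PolyHasDerivAt (p : ℝ → ℝ[X]) (p' : ℝ[X]) (t : ℝ) : Prop :=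
  (∃ N, ∀ s, (p s).natDegree ≤ N) ∧ ∀ i, HasDerivAt (fun s => (p s).coeff i) (p'.coeff i) t

namespace PolyHasDerivAt
variable {p q : ℝ → ℝ[X]} {p' q' : ℝ[X]} {t : ℝ}

theorem const (r : ℝ[X]) (t : ℝ) : PolyHasDerivAt (fun _ => r) 0 t :=
  ⟨⟨r.natDegree, fun _ => le_rfl⟩, fun i => by simpa using hasDerivAt_const t (r.coeff i)⟩

theorem mul (hp : PolyHasDerivAt p p' t) (hq : PolyHasDerivAt q q' t) :
    PolyHasDerivAt (fun s => p s * q s) (p' * q t + p t * q') t := by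
  obtain ⟨⟨N, hN⟩, hp⟩ := hp
  obtain ⟨⟨M, hM⟩, hq⟩ := hq
  refine ⟨⟨N + M, fun s => natDegree_mul_le.trans (add_le_add (hN s) (hM s))⟩, fun i => ?_⟩
  simp only [coeff_mul, coeff_add, ← Finset.sum_add_distrib]
  exact HasDerivAt.fun_sum fun x _ => (hp x.1).mul (hq x.2)

/-- The uniform degree bound makes `J` a finite sum of coefficients times moments; ∂_t w = -w/x²
raises the pole order by two. -/
theorem hasDerivAt_J {α : ℝ} (hα : 0 ≤ α) (ht : 0 < t) (hp : PolyHasDerivAt p p' t) (k : ℕ) :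
    HasDerivAt (fun s => J α s k (p s)) (J α t k p' - J α t (k + 2) (p t)) t := by
  obtain ⟨⟨N, hN⟩, hp⟩ := hp
  have hp' : p'.natDegree ≤ N := by
    rw [natDegree_le_iff_coeff_eq_zero]
    intro m hm
    have h0 : (fun s => (p s).coeff m) = fun _ => 0 :=
      funext fun s => coeff_eq_zero_of_natDegree_lt ((hN s).trans_lt hm)
    have := hp m
    rw [h0] at this
    exact this.unique (hasDerivAt_const t 0)
  have key : HasDerivAt
      (fun s => ∑ i ∈ Finset.range (N + 1), (p s).coeff i * moment α s ((i : ℤ) - k))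
      (∑ i ∈ Finset.range (N + 1), (p'.coeff i * moment α t ((i : ℤ) - k) +
        (p t).coeff i * -moment α t ((i : ℤ) - k - 2))) t :=
    HasDerivAt.fun_sum fun i _ => (hp i).mul (hasDerivAt_moment hα ht _)
  simp only [J_eq_sum α _ k _ (hN _), J_eq_sum α _ k _ hp', J_eq_sum α _ (k + 2) _ (hN _)]
  refine key.congr_deriv ?_
  rw [← Finset.sum_sub_distrib]
  refine Finset.sum_congr rfl fun i _ => ?_
  rw [show (i : ℤ) - k - 2 = i - ((k + 2 : ℕ) : ℤ) by push_cast; ring]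
  ring

end PolyHasDerivAt

/-- The derivative of `P_n(x,t)` with respect to `t`. -/
def Pdot (α t : ℝ) (n : ℕ) : ℝ[X] :=
  ∑ i ∈ Finset.range n, monomial i (deriv (fun s => (P α s n).coeff i) t)

section TimeDerivative
variable {α t : ℝ}

theorem Pdot_coeff (α t : ℝ) (n i : ℕ) :
    (Pdot α t n).coeff i = deriv (fun s => (P α s n).coeff i) t := by
  simp only [Pdot, finsetSum_coeff, coeff_monomial]
  rw [Finset.sum_ite_eq']
  split_ifs with hi
  · rfl
  · rw [Finset.mem_range, not_lt] at hi
    rcases hi.eq_or_lt with rfl | hi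
    · simp [P_coeff_self]
    · have : ∀ s, (P α s n).coeff i = 0 := fun s =>
        coeff_eq_zero_of_natDegree_lt (by rwa [P_natDegree])
      simp [this]

theorem Pdot_degree_lt (α t : ℝ) (n : ℕ) : (Pdot α t n).degree < n := by
  rw [degree_lt_iff_coeff_zero]
  intro m hm
  simp only [Pdot, finsetSum_coeff, coeff_monomial]
  rw [Finset.sum_ite_eq', if_neg (by simpa using hm)]

theorem P_polyHasDerivAt (hα : 0 < α) (ht : 0 < t) (n : ℕ) :
    PolyHasDerivAt (fun s => P α s n) (Pdot α t n) t := by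
  refine ⟨⟨n, fun s => (P_natDegree α s n).le⟩, ?_⟩
  induction n using Nat.strong_induction_on with
  | _ n ih =>
    intro i
    rw [Pdot_coeff]
    refine DifferentiableAt.hasDerivAt ?_
    have hpair : ∀ (k : Fin n) (q : ℝ → ℝ[X]) (q' : ℝ[X]), PolyHasDerivAt q q' t →
        DifferentiableAt ℝ (fun s => pairing α s (q s) (P α s k)) t := fun k q q' hq => by
      have hk : PolyHasDerivAt (fun s => P α s k) (Pdot α t k) t :=
        ⟨⟨k, fun s => (P_natDegree α s k).le⟩, ih k k.2⟩
      have h1 := ((hq.mul hk).hasDerivAt_J hα.le ht 0).differentiableAt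
      refine h1.congr_of_eventuallyEq ?_
      filter_upwards [Ioi_mem_nhds ht] with s hs
      exact pairing_eq_J hα.le hs _ _
    have h2 : ∀ s, (P α s n).coeff i = (X ^ n : ℝ[X]).coeff i - ∑ k : Fin n,
        pairing α s (X ^ n) (P α s k) / pairing α s (P α s k) (P α s k) * (P α s k).coeff i := by
      intro s
      conv_lhs => rw [P]
      simp [coeff_X_pow]
    simp only [h2]
    refine (differentiableAt_const _).sub (DifferentiableAt.fun_sum fun k _ => ?_)
    -- Differentiability passes through the Gram–Schmidt quotients because their denominators are
    -- positive.
    refine DifferentiableAt.mul (DifferentiableAt.div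
      (hpair k _ _ (PolyHasDerivAt.const _ t)) (hpair k _ _ ⟨⟨k, fun s => (P_natDegree α s k).le⟩,
        ih k k.2⟩) ?_) (ih k k.2 i).differentiableAt
    exact (pairing_self_pos hα ht.le (P_monic α t k).ne_zero).ne'

theorem Pdot_hasParity (hα : 0 ≤ α) (ht : 0 < t) (n : ℕ) : HasParity n (Pdot α t n) := by
  intro i hi
  rw [Pdot_coeff]
  have : (fun s => (P α s n).coeff i) =ᶠ[nhds t] fun _ => 0 := by
    filter_upwards [Ioi_mem_nhds ht] with s hs
    exact P_hasParity hα hs n i hi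
  rw [this.deriv_eq, deriv_const]

/-- Differentiate the orthogonality relation ∫ P_n f w = 0 with f fixed. -/
theorem J_Pdot_mul (hα : 0 < α) (ht : 0 < t) {n : ℕ} {f : ℝ[X]} (hf : f.degree < n) :
    J α t 0 (Pdot α t n * f) = J α t 2 (P α t n * f) := by
  have h1 := ((P_polyHasDerivAt hα ht n).mul (PolyHasDerivAt.const f t)).hasDerivAt_J hα.le ht 0
  have h2 : (fun s => J α s 0 (P α s n * f)) =ᶠ[nhds t] fun _ => 0 := by
    filter_upwards [Ioi_mem_nhds ht] with s hs
    exact J_P_mul_eq_zero hα hs hf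
  have h3 := (h1.congr_of_eventuallyEq h2.symm).unique (hasDerivAt_const t 0)
  rw [mul_zero, add_zero] at h3
  linarith

/-- The contribution 2∫ P_n ∂_tP_n w vanishes since ∂_tP_n has degree below n; only the derivative
of the weight survives. -/
theorem hasDerivAt_h (hα : 0 < α) (ht : 0 < t) (n : ℕ) :
    HasDerivAt (fun s => h α s n) (-J α t 2 (P α t n * P α t n)) t := by
  have h1 := ((P_polyHasDerivAt hα ht n).mul (P_polyHasDerivAt hα ht n)).hasDerivAt_J hα.le ht 0
  have h2 : (fun s => h α s n) =ᶠ[nhds t] fun s => J α s 0 (P α s n * P α s n) := by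
    filter_upwards [Ioi_mem_nhds ht] with s hs
    exact h_eq_J hα.le hs n
  refine (h1.congr_of_eventuallyEq h2).congr_deriv ?_
  rw [mul_comm (Pdot α t n), map_add, J_P_mul_eq_zero hα ht (Pdot_degree_lt α t n)]
  ring

end TimeDerivative
end SingularJacobi
end
-- Recurrence, integrals with a pole at 0, and the ladder in t
open Polynomial
noncomputable section
namespace SingularJacobi
section Ladder
variable {α t : ℝ}

theorem J_P_mul_P_of_ne (hα : 0 < α) (ht : 0 < t) {j k : ℕ} (hjk : j ≠ k) :
    J α t 0 (P α t j * P α t k) = 0 := by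
  rw [← pairing_eq_J hα.le ht]
  exact P_orthogonal hα ht.le hjk

theorem R_pos (hα : 0 < α) (ht : 0 < t) (n : ℕ) : 0 < R α n t := by
  rw [R_eq_J hα.le ht]
  have := h_pos hα ht.le n
  have := J_two_mul_self_pos hα ht (P_monic α t n).ne_zero
  positivity

theorem R_mul_h (hα : 0 < α) (ht : 0 < t) (n : ℕ) :
    R α n t * h α t n = 2 * t * J α t 2 (P α t n * P α t n) := by
  rw [R_eq_J hα.le ht]
  have := (h_pos hα ht.le n).ne'
  field_simp

theorem natDegree_sub_le_of_le_of_le {p q : ℝ[X]} {n : ℕ} (hp : p.natDegree ≤ n)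
    (hq : q.natDegree ≤ n) : (p - q).natDegree ≤ n :=
  (natDegree_sub_le p q).trans (max_le hp hq)

theorem natDegree_add_le_of_le_of_le {p q : ℝ[X]} {n : ℕ} (hp : p.natDegree ≤ n)
    (hq : q.natDegree ≤ n) : (p + q).natDegree ≤ n :=
  (natDegree_add_le p q).trans (max_le hp hq)

theorem X_mul_P_zero (hα : 0 < α) (ht : 0 < t) : X * P α t 0 - P α t 1 = 0 := by
  have hpar : HasParity 1 (X * P α t 0 - P α t 1) := by
    rw [P_zero, mul_one]
    exact (by simpa using HasParity.X_pow 1 : HasParity 1 X).sub (P_hasParity hα.le ht 1)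
  refine eq_zero_of_J_P_mul_eq_zero hα ht (N := 1) ?_ fun j hj => ?_
  · rw [P_zero, mul_one]
    exact natDegree_sub_le_of_le_of_le natDegree_X_le (P_natDegree α t 1).le
  · rcases Nat.le_one_iff_eq_zero_or_eq_one.1 hj with rfl | rfl
    · exact J_eq_zero_of_parity α t ((P_hasParity hα.le ht 0).mul hpar) (by decide)
    · rw [J_P_mul hα ht, coeff_sub, P_coeff_self, P_zero, mul_one, coeff_X_one, sub_self, zero_mul]
      rw [← natDegree_le_iff_degree_le, P_zero, mul_one]
      exact natDegree_sub_le_of_le_of_le natDegree_X_le (P_natDegree α t 1).le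

theorem degree_X_pow_mul_le {m j n : ℕ} {f : ℝ[X]} (hf : f.degree ≤ j) (h : m + j ≤ n) :
    (X ^ m * f).degree ≤ (n : WithBot ℕ) := by
  rw [← natDegree_le_iff_degree_le] at hf ⊢
  exact (natDegree_mul_le_of_le (natDegree_X_pow_le m) hf).trans h

theorem degree_X_mul_le {j n : ℕ} {f : ℝ[X]} (hf : f.degree ≤ j) (h : 1 + j ≤ n) :
    (X * f).degree ≤ (n : WithBot ℕ) := by
  simpa using degree_X_pow_mul_le (m := 1) hf h

theorem X_hasParity : HasParity 1 (X : ℝ[X]) := by simpa using HasParity.X_pow 1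

/-- The three term recurrence relation. -/
theorem X_mul_P_succ (hα : 0 < α) (ht : 0 < t) (n : ℕ) :
    X * P α t (n + 1) - P α t (n + 2) = C (h α t (n + 1) / h α t n) * P α t n := by
  have hn := (h_pos hα ht.le n).ne'
  set G := X * P α t (n + 1) - P α t (n + 2) - C (h α t (n + 1) / h α t n) * P α t n with hG
  have hdeg : G.natDegree ≤ n + 2 := by
    refine natDegree_sub_le_of_le_of_le (natDegree_sub_le_of_le_of_le ?_ ((P_natDegree _ _ _).trans_le (by omega))) ?_
    · exact natDegree_le_iff_degree_le.2 (degree_X_mul_le (P_degree _ _ _).le (by omega))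
    · exact (natDegree_C_mul_le _ _).trans ((P_natDegree _ _ _).trans_le (by omega))
  have hpar : HasParity n G := by
    refine (HasParity.sub ?_ ?_).sub ((P_hasParity hα.le ht n).C_mul _)
    · exact (X_hasParity.mul (P_hasParity hα.le ht (n + 1))).congr ⟨n + 1, by ring⟩
    · exact (P_hasParity hα.le ht (n + 2)).congr ⟨n + 1, by ring⟩
  refine sub_eq_zero.1 (eq_zero_of_J_P_mul_eq_zero hα ht hdeg fun j hj => ?_)
  rcases Nat.lt_or_ge n j with hnj | hnj
  · obtain rfl | rfl : j = n + 1 ∨ j = n + 2 := by omega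
    · exact J_eq_zero_of_parity α t ((P_hasParity hα.le ht (n + 1)).mul hpar) ⟨n, by ring⟩
    · rw [J_P_mul hα ht (natDegree_le_iff_degree_le.1 hdeg)]
      have h1 : (P α t n).coeff (n + 2) = 0 :=
        coeff_eq_zero_of_natDegree_lt (by rw [P_natDegree]; omega)
      simp [hG, P_coeff_self, h1, coeff_X_mul]
  · have e1 : J α t 0 (P α t j * (X * P α t (n + 1))) =
        (P α t j).coeff n * h α t (n + 1) := by
      rw [mul_left_comm, mul_comm (P α t j), mul_left_comm, J_P_mul hα ht, coeff_X_mul]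
      exact degree_X_mul_le (P_degree _ _ _).le (by omega)
    rw [mul_sub, mul_sub, map_sub, map_sub, e1, J_P_mul_P_of_ne hα ht (by omega),
      mul_left_comm, J_C_mul, mul_comm (P α t j), J_P_mul hα ht]
    · field_simp
      ring
    · rw [P_degree]; exact_mod_cast hnj

theorem degree_divX_lt {f : ℝ[X]} {n : ℕ} (hf : f.degree ≤ n) : f.divX.degree < n := by
  rw [degree_lt_iff_coeff_zero]
  intro m hm
  rw [coeff_divX]
  exact coeff_eq_zero_of_degree_lt (hf.trans_lt (by exact_mod_cast Nat.lt_succ_of_le hm))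

theorem degree_divX_le {f : ℝ[X]} {n : ℕ} (hf : f.degree ≤ (n + 1 : ℕ)) : f.divX.degree ≤ n := by
  rw [degree_le_iff_coeff_zero]
  intro m hm
  rw [coeff_divX]
  have hm' : n < m := by exact_mod_cast hm
  exact coeff_eq_zero_of_degree_lt (hf.trans_lt (by exact_mod_cast Nat.succ_lt_succ hm'))

/-- Splitting f = f(0) + x·`f.divX` lowers the pole order by one. Iterating until orthogonality
applies reduces integrals of P_n f x^{-k} w to low coefficients of f. -/
theorem J_succ_mul (α t : ℝ) (k : ℕ) (p f : ℝ[X]) :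
    J α t (k + 1) (p * f) = f.coeff 0 * J α t (k + 1) p + J α t k (p * f.divX) := by
  conv_lhs => rw [← divX_mul_X_add f]
  rw [mul_add, map_add, ← mul_assoc, mul_comm _ X, J_X_mul, mul_comm p (C _), J_C_mul, add_comm]

theorem J_one_P_mul (hα : 0 < α) (ht : 0 < t) {n : ℕ} {f : ℝ[X]} (hf : f.degree ≤ n) :
    J α t 1 (P α t n * f) = f.coeff 0 * J α t 1 (P α t n) := by
  rw [J_succ_mul, J_P_mul_eq_zero hα ht (degree_divX_lt hf), add_zero]

theorem J_two_P_mul (hα : 0 < α) (ht : 0 < t) {n : ℕ} {f : ℝ[X]} (hf : f.degree ≤ (n + 1 : ℕ)) :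
    J α t 2 (P α t n * f) = f.coeff 0 * J α t 2 (P α t n) + f.coeff 1 * J α t 1 (P α t n) := by
  rw [J_succ_mul, J_one_P_mul hα ht (degree_divX_le hf), coeff_divX]

theorem J_three_P_mul (hα : 0 < α) (ht : 0 < t) {n : ℕ} {f : ℝ[X]} (hf : f.degree ≤ (n + 2 : ℕ))
    (h0 : f.coeff 0 = 0) :
    J α t 3 (P α t n * f) = f.coeff 1 * J α t 2 (P α t n) + f.coeff 2 * J α t 1 (P α t n) := by
  rw [J_succ_mul, J_two_P_mul hα ht (degree_divX_le hf), coeff_divX, coeff_divX, h0]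
  ring

theorem J_one_P_mul_P_succ (hα : 0 < α) (ht : 0 < t) (n : ℕ) :
    J α t 1 (P α t n * P α t (n + 1)) = (P α t (n + 1)).coeff 0 * J α t 1 (P α t n) + h α t n := by
  rw [J_succ_mul, J_P_mul hα ht (degree_divX_le (P_degree _ _ _).le), coeff_divX, P_coeff_self,
    one_mul]

theorem J_one_P_succ_mul_P (hα : 0 < α) (ht : 0 < t) (n : ℕ) :
    J α t 1 (P α t n * P α t (n + 1)) = (P α t n).coeff 0 * J α t 1 (P α t (n + 1)) := by
  rw [mul_comm, J_one_P_mul hα ht]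
  rw [P_degree]
  exact_mod_cast n.le_succ

theorem P_coeff_eq_zero (hα : 0 < α) (ht : 0 < t) {n i : ℕ} (h : Odd (i + n)) :
    (P α t n).coeff i = 0 := P_hasParity hα.le ht n i h

/-- Compute ∫ P_n P_{n+1} w/x in two ways, splitting off the constant term of either factor; parity
kills P_{n+1}(0). -/
theorem h_eq_of_even (hα : 0 < α) (ht : 0 < t) {n : ℕ} (hn : Even n) :
    h α t n = (P α t n).coeff 0 * J α t 1 (P α t (n + 1)) := by
  have h1 := J_one_P_mul_P_succ hα ht n
  rw [J_one_P_succ_mul_P hα ht, P_coeff_eq_zero hα ht (n := n + 1) (by simpa using hn.add_one)]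
    at h1
  linarith

theorem h_eq_of_odd (hα : 0 < α) (ht : 0 < t) {n : ℕ} (hn : Odd n) :
    h α t n = -(P α t (n + 1)).coeff 0 * J α t 1 (P α t n) := by
  have h1 := J_one_P_mul_P_succ hα ht n
  rw [J_one_P_succ_mul_P hα ht, P_coeff_eq_zero hα ht (n := n) (by simpa using hn)] at h1
  linarith

theorem J_one_P_mul_P_succ_eq (hα : 0 < α) (ht : 0 < t) (n : ℕ) :
    J α t 1 (P α t n * P α t (n + 1)) = (1 + (-1) ^ n) / 2 * h α t n := by
  rcases Nat.even_or_odd n with hn | hn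
  · rw [J_one_P_succ_mul_P hα ht, ← h_eq_of_even hα ht hn, hn.neg_one_pow]; ring
  · rw [J_one_P_succ_mul_P hα ht, P_coeff_eq_zero hα ht (n := n) (by simpa using hn),
      hn.neg_one_pow]; ring

theorem P_coeff_zero_ne_zero (hα : 0 < α) (ht : 0 < t) {n : ℕ} (hn : Even n) :
    (P α t n).coeff 0 ≠ 0 := fun h0 => by
  have h1 := h_eq_of_even hα ht hn
  rw [h0, zero_mul] at h1
  exact (h_pos hα ht.le n).ne' h1

theorem J_two_P_mul_P_of_even (hα : 0 < α) (ht : 0 < t) {n : ℕ} (hn : Even n) :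
    J α t 2 (P α t n * P α t n) = (P α t n).coeff 0 * J α t 2 (P α t n) := by
  rw [J_two_P_mul hα ht, P_coeff_eq_zero hα ht (i := 1) (by simpa [add_comm] using hn.add_one)]
  · ring
  · rw [P_degree]; exact_mod_cast n.le_succ

theorem J_two_P_mul_P_of_odd (hα : 0 < α) (ht : 0 < t) {n : ℕ} (hn : Odd n) :
    J α t 2 (P α t n * P α t n) = (P α t n).coeff 1 * J α t 1 (P α t n) := by
  rw [J_two_P_mul hα ht, P_coeff_eq_zero hα ht (i := 0) (by simpa using hn)]
  · ring
  · rw [P_degree]; exact_mod_cast n.le_succ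

theorem P_coeff_one_ne_zero (hα : 0 < α) (ht : 0 < t) {n : ℕ} (hn : Odd n) :
    (P α t n).coeff 1 ≠ 0 := fun h0 => by
  have h1 := J_two_P_mul_P_of_odd hα ht hn
  rw [h0, zero_mul] at h1
  exact (J_two_mul_self_pos hα ht (P_monic α t n).ne_zero).ne' h1

theorem J_three_P_mul_P_succ_of_even (hα : 0 < α) (ht : 0 < t) {n : ℕ} (hn : Even n) :
    J α t 3 (P α t n * P α t (n + 1)) = (P α t (n + 1)).coeff 1 * J α t 2 (P α t n) := by
  rw [J_three_P_mul hα ht, P_coeff_eq_zero hα ht (i := 2) (n := n + 1)]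
  · ring
  · rw [add_comm]; exact hn.add_one.add_even even_two
  · rw [P_degree]; exact_mod_cast (n + 1).le_succ
  · exact P_coeff_eq_zero hα ht (by simpa using hn.add_one)

theorem J_three_P_mul_P_succ_of_odd (hα : 0 < α) (ht : 0 < t) {n : ℕ} (hn : Odd n) :
    J α t 3 (P α t n * P α t (n + 1)) = (P α t n).coeff 1 * J α t 2 (P α t (n + 1)) := by
  rw [mul_comm, J_three_P_mul hα ht, P_coeff_eq_zero hα ht (i := 2) (n := n)]
  · ring
  · rw [add_comm]; exact hn.add_even even_two
  · rw [P_degree]; exact_mod_cast (by omega)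
  · exact P_coeff_eq_zero hα ht (by simpa using hn)

/-- The auxiliary quantity `r_n(t) = (2t / h_{n-1}) ∫ P_n P_{n-1} w / y³ dy`, written as
`R_n - r_{n+1}`. -/
def auxR (α : ℝ) (n : ℕ) (t : ℝ) : ℝ :=
  R α n t - 2 * t / h α t n * J α t 3 (P α t n * P α t (n + 1))

theorem auxR_eq (hα : 0 < α) (ht : 0 < t) (n : ℕ) :
    auxR α n t = 2 * t / h α t n * J α t 3 (P α t n * (X * P α t n - P α t (n + 1))) := by
  rw [auxR, R_eq_J hα.le ht, mul_sub, map_sub, mul_left_comm (P α t n), J_X_mul]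
  ring

/-- Defining r_n as R_n - r_{n+1} makes sense at n = 0 without an h_{-1}; here P_1 = x forces the
value 0. -/
theorem auxR_zero (hα : 0 < α) (ht : 0 < t) : auxR α 0 t = 0 := by
  rw [auxR_eq hα ht, X_mul_P_zero hα ht, mul_zero, map_zero, mul_zero]

theorem auxR_succ (hα : 0 < α) (ht : 0 < t) (n : ℕ) :
    auxR α (n + 1) t = 2 * t / h α t n * J α t 3 (P α t n * P α t (n + 1)) := by
  rw [auxR_eq hα ht, X_mul_P_succ hα ht, mul_left_comm, J_C_mul, mul_comm (P α t (n + 1))]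
  have := (h_pos hα ht.le n).ne'
  have := (h_pos hα ht.le (n + 1)).ne'
  field_simp

theorem auxR_add_auxR_succ (hα : 0 < α) (ht : 0 < t) (n : ℕ) :
    auxR α n t + auxR α (n + 1) t = R α n t := by
  rw [auxR_succ hα ht, auxR, sub_add_cancel]

/-- By parity each of the pole integrals involved is a single coefficient times a single integral of
P_n or P_{n+1}; the two sides are the same product, up to the sign in h_n that depends on the parity
of n. -/
theorem R_mul_R_succ (hα : 0 < α) (ht : 0 < t) (n : ℕ) :
    h α t (n + 1) / h α t n * R α (n + 1) t * R α n t = 2 * t * (-1) ^ n * auxR α (n + 1) t := by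
  have key : J α t 2 (P α t (n + 1) * P α t (n + 1)) * J α t 2 (P α t n * P α t n) =
      (-1) ^ n * h α t n * J α t 3 (P α t n * P α t (n + 1)) := by
    rcases Nat.even_or_odd n with hn | hn
    · rw [J_two_P_mul_P_of_even hα ht hn, J_two_P_mul_P_of_odd hα ht hn.add_one,
        J_three_P_mul_P_succ_of_even hα ht hn, h_eq_of_even hα ht hn, hn.neg_one_pow]
      ring
    · rw [J_two_P_mul_P_of_odd hα ht hn, J_two_P_mul_P_of_even hα ht hn.add_one,
        J_three_P_mul_P_succ_of_odd hα ht hn, h_eq_of_odd hα ht hn, hn.neg_one_pow]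
      ring
  rw [auxR_succ hα ht, R_eq_J hα.le ht, R_eq_J hα.le ht]
  have := (h_pos hα ht.le n).ne'
  have := (h_pos hα ht.le (n + 1)).ne'
  field_simp
  linear_combination key

theorem J_Pdot_mul_of_degree_le (hα : 0 < α) (ht : 0 < t) {n : ℕ} {f : ℝ[X]} (hf : f.degree ≤ n) :
    J α t 0 (Pdot α t n * f) =
      J α t 2 (P α t n * f) - f.coeff n * J α t 2 (P α t n * P α t n) := by
  have h1 := J_Pdot_mul hα ht (degree_sub_C_coeff_mul_P_lt α t hf)
  rw [mul_sub, mul_sub, map_sub, map_sub, mul_left_comm, J_C_mul, mul_left_comm, J_C_mul,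
    mul_comm (Pdot α t n) (P α t n), J_P_mul_eq_zero hα ht (Pdot_degree_lt α t n)] at h1
  linarith

theorem Pdot_ladder (hα : 0 < α) (ht : 0 < t) (n : ℕ) :
    C (2 * t) * (X ^ 2 * Pdot α t n) + C (R α n t) * (X * (X * P α t n - P α t (n + 1))) =
      C (t * (1 - (-1) ^ n)) * P α t n := by
  have hh := (h_pos hα ht.le n).ne'
  obtain ⟨c, hc⟩ : ∃ c, C (2 * t) * (X ^ 2 * Pdot α t n) +
      C (R α n t) * (X * (X * P α t n - P α t (n + 1))) = C c * P α t n := by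
    set F := C (2 * t) * (X ^ 2 * Pdot α t n) +
      C (R α n t) * (X * (X * P α t n - P α t (n + 1))) with hF
    refine ⟨J α t 0 (P α t n * F) / h α t n, ?_⟩
    set c := J α t 0 (P α t n * F) / h α t n with hc
    have hdeg : (F - C c * P α t n).natDegree ≤ n + 2 := by
      refine natDegree_sub_le_of_le_of_le (natDegree_add_le_of_le_of_le ?_ ?_) ?_
      · refine (natDegree_C_mul_le _ _).trans (natDegree_le_iff_degree_le.2 ?_)
        exact degree_X_pow_mul_le (Pdot_degree_lt α t n).le (by omega)
      · refine (natDegree_C_mul_le _ _).trans (natDegree_le_iff_degree_le.2 ?_)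
        refine degree_X_mul_le (j := n + 1) ((degree_sub_le _ _).trans (max_le ?_ ?_)) (by omega)
        · exact degree_X_mul_le (P_degree _ _ _).le (by omega)
        · exact (P_degree _ _ _).le
      · exact (natDegree_C_mul_le _ _).trans ((P_natDegree _ _ _).trans_le (by omega))
    have hpar : HasParity n (F - C c * P α t n) := by
      refine (HasParity.add ?_ ?_).sub ((P_hasParity hα.le ht n).C_mul _)
      · exact (((HasParity.X_pow 2).mul (Pdot_hasParity hα.le ht n)).congr
          ⟨n + 1, by ring⟩).C_mul _
      · refine ((X_hasParity.mul (m := n + 1) (HasParity.sub ?_ (P_hasParity hα.le ht _))).congr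
          ⟨n + 1, by ring⟩).C_mul _
        exact (X_hasParity.mul (P_hasParity hα.le ht n)).congr ⟨n + 1, by ring⟩
    refine sub_eq_zero.1 (eq_zero_of_J_P_mul_eq_zero hα ht hdeg fun j hj => ?_)
    rcases Nat.even_or_odd (j + n) with hjn | hjn
    swap
    · exact J_eq_zero_of_parity α t ((P_hasParity hα.le ht j).mul hpar) (by simpa using hjn)
    rw [Nat.even_iff] at hjn
    obtain rfl | rfl | hj : j = n + 2 ∨ j = n ∨ j + 2 ≤ n := by omega
    · rw [J_P_mul hα ht (natDegree_le_iff_degree_le.1 hdeg)]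
      have h1 : (P α t n).coeff (n + 2) = 0 :=
        coeff_eq_zero_of_natDegree_lt (by rw [P_natDegree]; omega)
      have h2 : (Pdot α t n).coeff n = 0 := coeff_eq_zero_of_degree_lt (Pdot_degree_lt α t n)
      simp only [hF, h1, h2, coeff_sub, coeff_add, coeff_C_mul, coeff_X_mul, coeff_X_pow_mul,
        P_coeff_self]
      ring
    · rw [mul_sub, map_sub, mul_left_comm, J_C_mul, ← h_eq_J hα.le ht, hc]
      field_simp
      ring
    -- Only the x^n coefficient of x² P_j contributes, with factor R_n h_n - 2t ∫ P_n² w/x² = 0;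
    -- this is what makes R_n the right multiplier.
    · have hd : (X ^ 2 * P α t j).degree ≤ (n : WithBot ℕ) :=
        degree_X_pow_mul_le (P_degree _ _ _).le (by omega)
      have e1 : J α t 0 (P α t j * F) = 2 * t * J α t 0 (Pdot α t n * (X ^ 2 * P α t j)) +
          R α n t * (J α t 0 (P α t n * (X ^ 2 * P α t j)) -
            J α t 0 (P α t (n + 1) * (X * P α t j))) := by
        rw [← map_sub, ← J_C_mul, ← J_C_mul, ← map_add, hF]
        congr 1
        ring
      have e2 : J α t 2 (P α t n * (X ^ 2 * P α t j)) = 0 := by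
        rw [mul_left_comm, J_X_pow_mul α t 0 2, J_P_mul_P_of_ne hα ht (by omega)]
      have e3 : J α t 0 (P α t (n + 1) * (X * P α t j)) = 0 := by
        refine J_P_mul_eq_zero hα ht ((degree_X_mul_le (n := n) (P_degree _ _ _).le
          (by omega)).trans_lt ?_)
        exact_mod_cast n.lt_succ_self
      rw [mul_sub, map_sub, mul_left_comm (P α t j), J_C_mul, J_P_mul_P_of_ne hα ht (by omega),
        e1, J_Pdot_mul_of_degree_le hα ht hd, J_P_mul hα ht hd, e2, e3]
      linear_combination (X ^ 2 * P α t j).coeff n * R_mul_h hα ht n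
  -- The constant is read off at the lowest nonvanishing coefficient of P_n: that of 1 gives c = 0
  -- for even n, that of x gives c = 2t for odd n.
  rw [hc]
  congr 2
  rcases Nat.even_or_odd n with hn | hn
  · have h1 := congrArg (fun p => coeff p 0) hc
    simp [mul_assoc] at h1
    rw [hn.neg_one_pow, h1.resolve_right (P_coeff_zero_ne_zero hα ht hn)]
    ring
  · have h1 := congrArg (fun p => coeff p 1) hc
    have hX : (X ^ 2 * Pdot α t n).coeff 1 = 0 := by
      rw [coeff_X_pow_mul']; simp
    simp only [coeff_add, coeff_C_mul, hX, coeff_X_mul _ 0, coeff_sub, coeff_X_mul_zero] at h1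
    have h2 := R_mul_h hα ht n
    rw [J_two_P_mul_P_of_odd hα ht hn] at h2
    have h3 := h_eq_of_odd hα ht hn
    have h4 := P_coeff_one_ne_zero hα ht hn
    have h5 : J α t 1 (P α t n) ≠ 0 := fun h0 => hh (by rw [h3, h0, mul_zero])
    rw [hn.neg_one_pow]
    refine mul_right_cancel₀ (mul_ne_zero h4 h5) ?_
    linear_combination (-J α t 1 (P α t n)) * h1 + h2 - R α n t * h3

end Ladder
end SingularJacobi
end
-- The dilation ladder, values at x = 1, and the equation for R_n
open Polynomial
noncomputable section
namespace SingularJacobi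
section Ladder
variable {α t : ℝ}

theorem X_mul_derivative_coeff (p : ℝ[X]) (i : ℕ) :
    (X * derivative p).coeff i = i * p.coeff i := by
  rcases i with _ | i
  · simp
  · rw [coeff_X_mul, coeff_derivative]
    push_cast
    ring

theorem degree_X_mul_derivative_le {f : ℝ[X]} {n : ℕ} (hf : f.degree ≤ n) :
    (X * derivative f).degree ≤ (n : WithBot ℕ) := by
  rw [degree_le_iff_coeff_zero] at hf ⊢
  intro m hm
  rw [X_mul_derivative_coeff, hf m hm, mul_zero]

/-- Integration by parts moves the field onto f. The term -2t ∫ P_n f w/x² is the one that 2t ∂_tP_n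
compensates when f has degree below n. -/
theorem J_dilation_P_mul (hα : 0 < α) (ht : 0 < t) (n : ℕ) (f : ℝ[X]) :
    J α t 0 (X * (1 - X ^ 2) * derivative (P α t n) * f) =
      (3 + 2 * α) * J α t 0 (P α t n * (X ^ 2 * f)) - J α t 0 (P α t n * f)
      - J α t 0 (P α t n * (X * derivative f)) + J α t 0 (P α t n * (X ^ 2 * (X * derivative f)))
      - 2 * t * J α t 2 (P α t n * f) + 2 * t * J α t 0 (P α t n * f) := by
  have ibp := J_integration_by_parts hα ht 0 (X * (P α t n * f))
  have e1 : J α t 1 (X * (1 - X ^ 2) * derivative (X * (P α t n * f))) =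
      J α t 0 (P α t n * f) - J α t 0 (P α t n * (X ^ 2 * f)) +
      J α t 0 (X * (1 - X ^ 2) * derivative (P α t n) * f) +
      J α t 0 (P α t n * (X * derivative f)) -
      J α t 0 (P α t n * (X ^ 2 * (X * derivative f))) := by
    rw [← map_sub, ← map_add, ← map_add, ← map_sub, ← J_X_mul α t 0]
    congr 1
    simp only [derivative_mul, derivative_X]
    ring
  have e2 : J α t 0 (X * (X * (P α t n * f))) = J α t 0 (P α t n * (X ^ 2 * f)) := by
    congr 1; ring
  have e3 : J α t 3 ((1 - X ^ 2) * (X * (P α t n * f))) =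
      J α t 2 (P α t n * f) - J α t 0 (P α t n * f) := by
    rw [← J_X_pow_mul α t 0 2, ← map_sub, ← J_X_mul α t 2]
    congr 1
    ring
  simp only [zero_add, Nat.cast_zero, zero_mul, sub_zero] at ibp
  rw [e1, e2, e3] at ibp
  linear_combination ibp

theorem exists_dilation_ladder (hα : 0 < α) (ht : 0 < t) (n : ℕ) :
    ∃ c : ℝ, X * (1 - X ^ 2) * derivative (P α t n) + C (2 * t) * Pdot α t n =
      C (2 * n + 2 * α + 1) * (X * (X * P α t n - P α t (n + 1)))
        - C (n : ℝ) * (X ^ 2 * P α t n) - C c * P α t n := by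
  have hh := (h_pos hα ht.le n).ne'
  set F := X * (1 - X ^ 2) * derivative (P α t n) + C (2 * t) * Pdot α t n
    - C (2 * n + 2 * α + 1) * (X * (X * P α t n - P α t (n + 1)))
    + C (n : ℝ) * (X ^ 2 * P α t n) with hF
  have hX : X * (1 - X ^ 2) * derivative (P α t n) =
      X * derivative (P α t n) - X ^ 2 * (X * derivative (P α t n)) := by ring
  have hP := (P_degree α t n).le
  have hP' := degree_X_mul_derivative_le hP
  refine ⟨-(J α t 0 (P α t n * F) / h α t n), ?_⟩
  set c := J α t 0 (P α t n * F) / h α t n with hc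
  suffices hFc : F = C c * P α t n by
    rw [C_neg]
    linear_combination hFc
  have hdeg : (F - C c * P α t n).natDegree ≤ n + 2 := by
    refine natDegree_sub_le_of_le_of_le (natDegree_add_le_of_le_of_le (natDegree_sub_le_of_le_of_le
      (natDegree_add_le_of_le_of_le ?_ ?_) ?_) ?_) ?_
    · rw [hX]
      refine natDegree_sub_le_of_le_of_le ?_ ?_
      · exact (natDegree_le_iff_degree_le.2 hP').trans (by omega)
      · exact natDegree_le_iff_degree_le.2 (degree_X_pow_mul_le hP' (by omega))
    · refine (natDegree_C_mul_le _ _).trans ?_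
      exact (natDegree_le_iff_degree_le.2 (Pdot_degree_lt α t n).le).trans (by omega)
    · refine (natDegree_C_mul_le _ _).trans (natDegree_le_iff_degree_le.2 ?_)
      refine degree_X_mul_le (j := n + 1) ((degree_sub_le _ _).trans (max_le ?_ ?_)) (by omega)
      · exact degree_X_mul_le hP (by omega)
      · exact (P_degree _ _ _).le
    · refine (natDegree_C_mul_le _ _).trans (natDegree_le_iff_degree_le.2 ?_)
      exact degree_X_pow_mul_le hP (by omega)
    · exact (natDegree_C_mul_le _ _).trans ((P_natDegree _ _ _).trans_le (by omega))
  have hPp := P_hasParity hα.le ht n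
  have hpar : HasParity n (F - C c * P α t n) := by
    have hX2 : HasParity n (X * derivative (P α t n)) :=
      (X_hasParity.mul hPp.derivative).congr ⟨n + 1, by ring⟩
    refine (((HasParity.add ?_ ?_).sub ?_).add ?_).sub (hPp.C_mul _)
    · rw [hX]
      exact hX2.sub (((HasParity.X_pow 2).mul hX2).congr ⟨n + 1, by ring⟩)
    · exact (Pdot_hasParity hα.le ht n).C_mul _
    · refine ((X_hasParity.mul (m := n + 1) (HasParity.sub ?_ (P_hasParity hα.le ht _))).congr
        ⟨n + 1, by ring⟩).C_mul _
      exact (X_hasParity.mul hPp).congr ⟨n + 1, by ring⟩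
    · exact (((HasParity.X_pow 2).mul hPp).congr ⟨n + 1, by ring⟩).C_mul _
  refine sub_eq_zero.1 (eq_zero_of_J_P_mul_eq_zero hα ht hdeg fun j hj => ?_)
  rcases Nat.even_or_odd (j + n) with hjn | hjn
  swap
  · exact J_eq_zero_of_parity α t ((P_hasParity hα.le ht j).mul hpar) (by simpa using hjn)
  rw [Nat.even_iff] at hjn
  obtain rfl | rfl | hj : j = n + 2 ∨ j = n ∨ j + 2 ≤ n := by omega
  · rw [J_P_mul hα ht (natDegree_le_iff_degree_le.1 hdeg)]
    have h1 : (P α t n).coeff (n + 2) = 0 :=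
      coeff_eq_zero_of_natDegree_lt (by rw [P_natDegree]; omega)
    have h2 : (Pdot α t n).coeff (n + 2) = 0 := coeff_eq_zero_of_degree_lt
      ((Pdot_degree_lt α t n).trans_le (by exact_mod_cast (by omega)))
    simp only [hF, hX, h1, h2, coeff_sub, coeff_add, coeff_C_mul, coeff_X_pow_mul,
      X_mul_derivative_coeff]
    simp only [coeff_X_mul, coeff_sub, P_coeff_self]
    ring
  · rw [mul_sub, map_sub, mul_left_comm, J_C_mul, ← h_eq_J hα.le ht, hc]
    field_simp
    ring
  -- With m = n-2, the x^m coefficient of f is multiplied by (3+2α) + m - (2n+2α+1) + n = 0; this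
  -- fixes the constant 2n+2α+1.
  · obtain ⟨m, rfl⟩ := Nat.exists_eq_add_of_le' (Nat.le_of_add_left_le hj)
    set f := P α t j with hf
    have hfd : f.degree ≤ m := by rw [hf, P_degree]; exact_mod_cast (by omega)
    have hfd' := degree_X_mul_derivative_le hfd
    have hm2 : ((m : ℕ) : WithBot ℕ) < ((m + 2 : ℕ) : WithBot ℕ) := by exact_mod_cast (by omega)
    have e1 : J α t 0 (f * F) =
        J α t 0 (X * (1 - X ^ 2) * derivative (P α t (m + 2)) * f)
        + 2 * t * J α t 0 (Pdot α t (m + 2) * f)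
        - (2 * (m + 2 : ℕ) + 2 * α + 1) * (J α t 0 (P α t (m + 2) * (X ^ 2 * f))
          - J α t 0 (P α t (m + 2 + 1) * (X * f)))
        + (m + 2 : ℕ) * J α t 0 (P α t (m + 2) * (X ^ 2 * f)) := by
      rw [← map_sub, ← J_C_mul, ← J_C_mul, ← J_C_mul, ← map_add, ← map_sub, ← map_add, hF]
      congr 1
      ring
    have e2 : J α t 0 (P α t (m + 2 + 1) * (X * f)) = 0 := by
      refine J_P_mul_eq_zero hα ht ((degree_X_mul_le (n := m + 1) hfd (by omega)).trans_lt ?_)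
      exact_mod_cast (by omega)
    have e3 : J α t 0 (P α t (m + 2) * f) = 0 := J_P_mul_eq_zero hα ht (hfd.trans_lt hm2)
    have e4 : J α t 0 (P α t (m + 2) * (X * derivative f)) = 0 :=
      J_P_mul_eq_zero hα ht (hfd'.trans_lt hm2)
    rw [mul_sub, map_sub, mul_left_comm f, J_C_mul, mul_comm f (P α t (m + 2)), e3, e1,
      J_dilation_P_mul hα ht, J_Pdot_mul hα ht (hfd.trans_lt hm2), e2, e3, e4,
      J_P_mul hα ht (degree_X_pow_mul_le hfd (by omega)),
      J_P_mul hα ht (degree_X_pow_mul_le hfd' (by omega)), coeff_X_pow_mul, coeff_X_pow_mul,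
      X_mul_derivative_coeff]
    push_cast
    ring

theorem dilation_ladder (hα : 0 < α) (ht : 0 < t) (n : ℕ) :
    X * (1 - X ^ 2) * derivative (P α t n) + C (2 * t) * Pdot α t n =
      C (2 * n + 2 * α + 1) * (X * (X * P α t n - P α t (n + 1)))
        - C (n : ℝ) * (X ^ 2 * P α t n)
        - C (auxR α n t - t * (1 - (-1) ^ n)) * P α t n := by
  obtain ⟨c, hc⟩ := exists_dilation_ladder hα ht n
  have hT := Pdot_ladder hα ht n
  have hh := (h_pos hα ht.le n).ne'
  suffices c = auxR α n t - t * (1 - (-1) ^ n) by rw [hc, this]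
  rcases Nat.even_or_odd n with hn | hn
  -- Even n: the constant term of the identity contains ∂_tP_n(0), which the x² coefficient of
  -- `Pdot_ladder` supplies.
  · have h0 := P_coeff_zero_ne_zero hα ht hn
    have h1 := congrArg (fun p => coeff p 0) hc
    have h2 := congrArg (fun p => coeff p 2) hT
    have hX2 : ∀ p : ℝ[X], (X ^ 2 * p).coeff 2 = p.coeff 0 := fun p => coeff_X_pow_mul p 2 0
    have hX1 : ∀ p : ℝ[X], (X * p).coeff 2 = p.coeff 1 := fun p => coeff_X_mul p 1
    have hX0 : ∀ p : ℝ[X], (X * p).coeff 1 = p.coeff 0 := fun p => coeff_X_mul p 0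
    have hX00 : (X ^ 2 : ℝ[X]).coeff 0 = 0 := by simp
    simp only [coeff_add, coeff_sub, coeff_C_mul, mul_coeff_zero, coeff_X_zero, hX00, hX2, hX1,
      hX0, hn.neg_one_pow, coeff_C_zero] at h1 h2
    rw [auxR, hn.neg_one_pow, J_three_P_mul_P_succ_of_even hα ht hn]
    have h3 := R_mul_h hα ht n
    rw [J_two_P_mul_P_of_even hα ht hn] at h3
    refine mul_right_cancel₀ h0 ?_
    clear h0
    field_simp
    linear_combination h α t n * h1 - h α t n * h2 - (P α t (n + 1)).coeff 1 * h3
  -- Odd n: comparing low coefficients would bring in the x³ coefficient of P_n. Instead ∂_tP_n is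
  -- eliminated between the two ladders, and the result is multiplied by P_{n-1} and integrated
  -- against w/x³.
  · obtain ⟨m, rfl⟩ : ∃ m, n = m + 1 := ⟨n - 1, by have := hn.pos; omega⟩
    have hm : Even m := by simpa [Nat.odd_add_one] using hn
    have hhm := (h_pos hα ht.le m).ne'
    rw [hn.neg_one_pow] at hT ⊢
    have hP := (P_degree α t m).le
    have hP1 : (P α t m).degree < ((m + 1 : ℕ) : WithBot ℕ) := by
      rw [P_degree]; exact_mod_cast m.lt_succ_self
    have hd := degree_X_mul_derivative_le hP
    have hJ1 := J_one_P_mul_P_succ_eq hα ht m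
    rw [hm.neg_one_pow, mul_comm] at hJ1
    have hJX : J α t 0 (P α t (m + 1) * (X * P α t m)) = h α t (m + 1) := by
      rw [J_P_mul hα ht (degree_X_mul_le hP (by omega)), coeff_X_mul, P_coeff_self, one_mul]
    have ibp := J_integration_by_parts hα ht 0 (P α t (m + 1) * P α t m)
    have hD : J α t 1 (X * (1 - X ^ 2) * derivative (P α t (m + 1)) * P α t m) =
        (m + 2 + 2 * α) * h α t (m + 1) - 2 * t * J α t 3 (P α t (m + 1) * P α t m)
          + 2 * t * h α t m := by
      have e1 : J α t 1 (X * (1 - X ^ 2) * derivative (P α t (m + 1) * P α t m)) =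
          J α t 1 (X * (1 - X ^ 2) * derivative (P α t (m + 1)) * P α t m)
          + J α t 0 (P α t (m + 1) * derivative (P α t m))
          - J α t 0 (P α t (m + 1) * (X * (X * derivative (P α t m)))) := by
        rw [← J_X_mul α t 0 (_ * derivative _), ← J_X_mul α t 0 (_ * (X * _)), ← map_add, ← map_sub]
        congr 1
        simp only [derivative_mul]
        ring
      have e2 : J α t 0 (P α t (m + 1) * derivative (P α t m)) = 0 :=
        J_P_mul_eq_zero hα ht ((degree_derivative_le).trans_lt hP1)
      have e3 : J α t 0 (P α t (m + 1) * (X * (X * derivative (P α t m)))) =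
          m * h α t (m + 1) := by
        rw [J_P_mul hα ht (degree_X_mul_le hd (by omega)), coeff_X_mul, X_mul_derivative_coeff,
          P_coeff_self, mul_one]
      have e4 : J α t 3 ((1 - X ^ 2) * (P α t (m + 1) * P α t m)) =
          J α t 3 (P α t (m + 1) * P α t m) - J α t 1 (P α t (m + 1) * P α t m) := by
        rw [← J_X_pow_mul α t 1 2, ← map_sub]
        congr 1
        ring
      simp only [zero_add, Nat.cast_zero, zero_mul, sub_zero] at ibp
      rw [e1, e2, e3, e4, hJ1, mul_left_comm, hJX] at ibp
      linear_combination ibp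
    have hq := X_mul_P_succ hα ht m
    rw [hq] at hT hc
    set β := h α t (m + 1) / h α t m with hβ
    have hmain : X ^ 3 * ((1 - X ^ 2) * derivative (P α t (m + 1)) * P α t m) =
        C ((2 * (m + 1 : ℕ) + 2 * α + 1) * β) * (X ^ 3 * (P α t m * P α t m))
        - C ((m + 1 : ℕ) : ℝ) * (X ^ 3 * (P α t (m + 1) * (X * P α t m)))
        - C c * (X ^ 2 * (P α t (m + 1) * P α t m))
        - C (t * 2) * (P α t (m + 1) * P α t m)
        + C (R α (m + 1) t * β) * (X * (P α t m * P α t m)) := by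
      have e5 : C (t * (1 - -1)) = C (t * 2) := by norm_num
      rw [e5] at hT
      simp only [C_mul] at hT hc ⊢
      linear_combination (X ^ 2 * P α t m) * hc - P α t m * hT
    have hmain' := congrArg (J α t 3) hmain
    simp only [map_add, map_sub, J_C_mul, J_X_pow_mul α t 0 3, J_X_pow_mul α t 1 2,
      J_X_mul α t 2] at hmain'
    rw [← J_X_mul, ← mul_assoc, ← mul_assoc, hD, ← h_eq_J hα.le ht, hJX, hJ1] at hmain'
    have hE := R_mul_R_succ hα ht m
    rw [← hβ, hm.neg_one_pow] at hE
    have h3 := R_mul_h hα ht m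
    have hβh : β * h α t m = h α t (m + 1) := by rw [hβ]; field_simp
    refine mul_right_cancel₀ (mul_ne_zero hhm ht.ne') ?_
    push_cast at hmain'
    clear_value β
    linear_combination t * hmain' + (2 * (m + 1) + 2 * α + 1) * t * hβh + h α t m * hE / 2
      - R α (m + 1) t * β * h3 / 2

/-- At x = 1 the factor 1-x² kills the x-derivative, and subtracting the two ladders cancels ∂_tP_n.
-/
theorem P_eval_one_succ (hα : 0 < α) (ht : 0 < t) (n : ℕ) :
    (2 * n + 2 * α + 1 + R α n t) * (P α t (n + 1)).eval 1 =
      (auxR α (n + 1) t + n + 1 + 2 * α) * (P α t n).eval 1 := by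
  have h1 := congrArg (eval 1) (dilation_ladder hα ht n)
  have h2 := congrArg (eval 1) (Pdot_ladder hα ht n)
  have h3 := auxR_add_auxR_succ hα ht n
  simp only [eval_add, eval_sub, eval_mul, eval_C, eval_X, eval_pow, eval_one] at h1 h2
  linear_combination h1 - h2 - (P α t n).eval 1 * h3

theorem P_eval_one_succ' (hα : 0 < α) (ht : 0 < t) (n : ℕ) :
    (2 * (n + 1) + 2 * α + 1 + R α (n + 1) t) * (h α t (n + 1) / h α t n) * (P α t n).eval 1 =
      (auxR α (n + 1) t + n + 1) * (P α t (n + 1)).eval 1 := by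
  have h1 := congrArg (eval 1) (dilation_ladder hα ht (n + 1))
  have h2 := congrArg (eval 1) (Pdot_ladder hα ht (n + 1))
  rw [X_mul_P_succ hα ht] at h1 h2
  simp only [eval_add, eval_sub, eval_mul, eval_C, eval_X, eval_pow, eval_one] at h1 h2
  push_cast at h1
  linear_combination h2 - h1

theorem P_eval_one_ne_zero (hα : 0 < α) (ht : 0 < t) (n : ℕ) : (P α t n).eval 1 ≠ 0 := by
  induction n with
  | zero => simp [P_zero]
  | succ n ih =>
    intro h0
    have h1 := P_eval_one_succ' hα ht n
    rw [h0, mul_zero] at h1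
    have := R_pos hα ht (n + 1)
    have := h_pos hα ht.le n
    have := h_pos hα ht.le (n + 1)
    refine mul_ne_zero (ne_of_gt ?_) ih h1
    positivity

/-- The two relations between P_n(1) and P_{n+1}(1) are compatible with P_n(1) ≠ 0 only if their
coefficients satisfy this. -/
theorem add_R_mul_add_R_succ (hα : 0 < α) (ht : 0 < t) (n : ℕ) :
    h α t (n + 1) / h α t n * (2 * (n + 1) + 2 * α + 1 + R α (n + 1) t) *
      (2 * n + 2 * α + 1 + R α n t) =
      (auxR α (n + 1) t + n + 1) * (auxR α (n + 1) t + n + 1 + 2 * α) := by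
  refine mul_right_cancel₀ (P_eval_one_ne_zero hα ht n) ?_
  linear_combination (2 * n + 2 * α + 1 + R α n t) * P_eval_one_succ' hα ht n +
    (auxR α (n + 1) t + n + 1) * P_eval_one_succ hα ht n

/-- The Riccati-type equation for `R_n`. -/
theorem hasDerivAt_R (hα : 0 < α) (ht : 0 < t) (n : ℕ) :
    HasDerivAt (R α n) ((R α n t * (1 + R α n t) / 2 - auxR α n t * R α n t
      - (-1) ^ n * t * (R α n t + (2 * n + 2 * α + 1))) / t) t := by
  have hh := (h_pos hα ht.le n).ne'
  have hP := P_polyHasDerivAt hα ht n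
  have hQ := (hP.mul hP).hasDerivAt_J hα.le ht 2
  have hd := (((hasDerivAt_id t).const_mul 2).div (hasDerivAt_h hα ht n) hh).mul hQ
  have hev : R α n =ᶠ[nhds t]
      fun s => 2 * id s / h α s n * J α s 2 (P α s n * P α s n) := by
    filter_upwards [Ioi_mem_nhds ht] with s hs
    exact R_eq_J hα.le hs n
  refine (hd.congr_of_eventuallyEq hev).congr_deriv ?_
  have hJ1 : J α t 1 (P α t n * (X * P α t n - P α t (n + 1))) =
      (1 - (-1) ^ n) / 2 * h α t n := by
    have e : J α t 1 (P α t n * (X * P α t n)) = h α t n := by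
      rw [mul_left_comm, J_X_mul, h_eq_J hα.le ht]
    rw [mul_sub, map_sub, e, J_one_P_mul_P_succ_eq hα ht]
    ring
  -- Differentiating ∫ P_n² w/x² produces 2∫ P_n ∂_tP_n w/x² - ∫ P_n² w/x⁴. The dilation ladder
  -- supplies the first integral, and this integration by parts removes both the x-derivative and
  -- the fourth-order pole.
  have ibp := J_integration_by_parts hα ht 1 (P α t n * P α t n)
  have e1 : J α t 2 (X * (1 - X ^ 2) * derivative (P α t n * P α t n)) =
      2 * J α t 2 (X * (1 - X ^ 2) * derivative (P α t n) * P α t n) := by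
    rw [← J_C_mul]
    congr 1
    simp only [derivative_mul]
    rw [show (C 2 : ℝ[X]) = 2 from rfl]
    ring
  have e2 : ∀ k, J α t (k + 2) ((1 - X ^ 2) * (P α t n * P α t n)) =
      J α t (k + 2) (P α t n * P α t n) - J α t k (P α t n * P α t n) := fun k => by
    rw [← J_X_pow_mul α t k 2, ← map_sub]
    congr 1
    ring
  have e3 := e2 0
  have e4 := e2 2
  have e5 : J α t 1 (X * (P α t n * P α t n)) = h α t n := by rw [J_X_mul, h_eq_J hα.le ht]
  rw [zero_add, ← h_eq_J hα.le ht] at e3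
  simp only [Nat.cast_one, one_mul, Nat.reduceAdd] at ibp e4
  rw [e1, e3, e4, e5] at ibp
  have hD := dilation_ladder hα ht n
  obtain ⟨κ, hκ⟩ : ∃ κ, auxR α n t - t * (1 - (-1) ^ n) = κ := ⟨_, rfl⟩
  obtain ⟨a, ha⟩ : ∃ a, 2 * n + 2 * α + 1 = a := ⟨_, rfl⟩
  rw [hκ, ha] at hD
  have hL := congrArg (fun p => J α t 2 (p * P α t n)) hD
  have e6 : (C a * (X * (X * P α t n - P α t (n + 1))) - C (n : ℝ) * (X ^ 2 * P α t n)
        - C κ * P α t n) * P α t n =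
      C a * (X * (P α t n * (X * P α t n - P α t (n + 1))))
        - C (n : ℝ) * (X ^ 2 * (P α t n * P α t n)) - C κ * (P α t n * P α t n) := by ring
  simp only [e6, add_mul, mul_assoc (C (2 * t)), map_add, map_sub, J_C_mul, J_X_mul α t 1,
    J_X_pow_mul α t 0 2] at hL
  rw [hJ1, ← h_eq_J hα.le ht, ← hκ, ← ha] at hL
  simp only [Pi.div_apply, id]
  rw [mul_comm (P α t n) (Pdot α t n), map_add, R_eq_J hα.le ht n]
  field_simp
  linear_combination 2 * h α t n * hL - h α t n * ibp

end Ladder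
end SingularJacobi
end
-- The closed first-order system and its reduction to Painlevé V
open Polynomial
noncomputable section
namespace SingularJacobi
section Painleve
variable {α t : ℝ}

theorem hasDerivAt_h_succ_div_h (hα : 0 < α) (ht : 0 < t) (n : ℕ) :
    HasDerivAt (fun s => h α s (n + 1) / h α s n)
      (h α t (n + 1) / h α t n * (R α n t - R α (n + 1) t) / (2 * t)) t := by
  have h0 := (h_pos hα ht.le n).ne'
  refine ((hasDerivAt_h hα ht (n + 1)).fun_div (hasDerivAt_h hα ht n) h0).congr_deriv ?_
  have e0 := R_mul_h hα ht n
  have e1 := R_mul_h hα ht (n + 1)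
  field_simp
  linear_combination h α t n * e1 - h α t (n + 1) * e0

/-- For positive index, differentiate the product formula for r given by `R_mul_R_succ`; the
algebraic relations then remove β and the neighbouring R, leaving quantities of one index. At index
0 both sides vanish. -/
theorem hasDerivAt_auxR (hα : 0 < α) (ht : 0 < t) (n : ℕ) :
    HasDerivAt (auxR α n)
      ((-t * (-1) ^ n * auxR α n t * (R α n t + (2 * n + 2 * α + 1)) / R α n t
        - R α n t * ((auxR α n t + n) * (auxR α n t + n + 2 * α))
          / (2 * (R α n t + (2 * n + 2 * α + 1)))) / t) t := by
  rcases n with _ | n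
  · have hev : auxR α 0 =ᶠ[nhds t] fun _ => 0 := by
      filter_upwards [Ioi_mem_nhds ht] with s hs
      exact auxR_zero hα hs
    refine ((hasDerivAt_const t 0).congr_of_eventuallyEq hev).congr_deriv ?_
    rw [auxR_zero hα ht]
    simp
  · have hσ : ((-1 : ℝ) ^ n) ^ 2 = 1 := by rw [← pow_mul, mul_comm, pow_mul]; simp
    have hev : auxR α (n + 1) =ᶠ[nhds t] fun s =>
        (-1) ^ n / 2 * (h α s (n + 1) / h α s n * R α (n + 1) s * R α n s / id s) := by
      filter_upwards [Ioi_mem_nhds ht] with s hs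
      have hs' : s ≠ 0 := ne_of_gt hs
      rw [R_mul_R_succ hα hs, id]
      field_simp
      linear_combination (-auxR α (n + 1) s) * hσ
    have hd := ((((hasDerivAt_h_succ_div_h hα ht n).fun_mul (hasDerivAt_R hα ht (n + 1))).fun_mul
      (hasDerivAt_R hα ht n)).fun_div (hasDerivAt_id t) ht.ne').const_mul ((-1 : ℝ) ^ n / 2)
    refine (hd.congr_of_eventuallyEq hev).congr_deriv ?_
    have e1 := R_mul_R_succ hα ht n
    have e2 := add_R_mul_add_R_succ hα ht n
    have e3 := auxR_add_auxR_succ hα ht n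
    have hR := R_pos hα ht (n + 1)
    have hRa : 0 < R α (n + 1) t + (2 * (n + 1) + 2 * α + 1) := by positivity
    simp only [id, pow_succ (-1 : ℝ) n]
    push_cast
    obtain ⟨β, hβ⟩ : ∃ β, h α t (n + 1) / h α t n = β := ⟨_, rfl⟩
    rw [hβ] at e1 e2 ⊢
    rw [eq_sub_of_add_eq e3]
    generalize R α (n + 1) t = R₁ at *
    generalize R α n t = R₀ at *
    generalize auxR α (n + 1) t = r at *
    generalize (-1 : ℝ) ^ n = σ at *
    have hr : r = β * R₁ * R₀ * σ / (2 * t) := by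
      rw [eq_div_iff (by positivity)]
      linear_combination (-2 * t * r) * hσ - σ * e1
    -- Trading r and this product for expressions in β, R₀, R₁ turns the goal into a rational
    -- identity in independent variables.
    have hY : (r + (n + 1)) * (r + (n + 1) + 2 * α) =
        β * (2 * (n + 1) + 2 * α + 1 + R₁) * (2 * n + 2 * α + 1 + R₀) := by
      linear_combination -e2
    rw [hY, hr]
    field_simp
    rcases sq_eq_one_iff.1 hσ with rfl | rfl <;> ring

theorem two_mul_natCast_add_pos (hα : 0 < α) (n : ℕ) : 0 < 2 * (n : ℝ) + 2 * α + 1 := by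
  positivity

/-- Elimination of r: `h₁` and `h₂` are the first-order system and `h₃` is the derivative of `h₁`
multiplied by t. Once R₁, r₁, R₂ are substituted, r cancels identically. -/
theorem painleve_polynomial_identity {t R r R₁ R₂ r₁ a α σ : ℝ} (ht : t ≠ 0) (hR : R ≠ 0)
    (hRa : R + a ≠ 0) (hσ : σ ^ 2 = 1)
    (h₁ : R₁ = (R * (1 + R) / 2 - r * R - σ * t * (R + a)) / t)
    (h₂ : r₁ = (-t * σ * r * (R + a) / R
      - R * ((r + (a - 1) / 2) ^ 2 - α ^ 2) / (2 * (R + a))) / t)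
    (h₃ : R₁ + t * R₂ =
      (1 + 2 * R) / 2 * R₁ - r₁ * R - r * R₁ - σ * (R + a) - σ * t * R₁) :
    8 * t ^ 2 * R * (a + R) * R₂ - 4 * t ^ 2 * (2 * a + 3 * R) * R₁ ^ 2 + 8 * t * (a + R) * R * R₁
      - R ^ 5 - 2 * a * R ^ 4 - (a ^ 2 - 4 * α ^ 2 - 4 * t ^ 2 - 4 * σ * t) * R ^ 3
      + 8 * t * a * (σ + 2 * t) * R ^ 2 + 4 * t * a ^ 2 * (σ + 5 * t) * R
      + 8 * t ^ 2 * a ^ 3 = 0 := by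
  have h₄ : R₂ = ((1 + 2 * R) / 2 * R₁ - r₁ * R - r * R₁ - σ * (R + a) - σ * t * R₁ - R₁) / t := by
    rw [eq_div_iff ht]; linarith
  have hRa' : a + R ≠ 0 := by rwa [add_comm]
  rw [h₄, h₂, h₁]
  rcases sq_eq_one_iff.1 hσ with rfl | rfl <;> field_simp <;> ring

theorem R_second_order (hα : 0 < α) (ht : 0 < t) (n : ℕ) :
    DifferentiableAt ℝ (R α n) t ∧ DifferentiableAt ℝ (deriv (R α n)) t ∧
    8 * t ^ 2 * R α n t * ((2 * n + 2 * α + 1) + R α n t) * deriv (deriv (R α n)) t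
      - 4 * t ^ 2 * (2 * (2 * n + 2 * α + 1) + 3 * R α n t) * deriv (R α n) t ^ 2
      + 8 * t * ((2 * n + 2 * α + 1) + R α n t) * R α n t * deriv (R α n) t
      - R α n t ^ 5 - 2 * (2 * n + 2 * α + 1) * R α n t ^ 4
      - ((2 * n + 2 * α + 1) ^ 2 - 4 * α ^ 2 - 4 * t ^ 2 - 4 * (-1) ^ n * t) * R α n t ^ 3
      + 8 * t * (2 * n + 2 * α + 1) * ((-1) ^ n + 2 * t) * R α n t ^ 2
      + 4 * t * (2 * n + 2 * α + 1) ^ 2 * ((-1) ^ n + 5 * t) * R α n t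
      + 8 * t ^ 2 * (2 * n + 2 * α + 1) ^ 3 = 0 := by
  have hd := hasDerivAt_R hα ht n
  have hr := hasDerivAt_auxR hα ht n
  have hf := ((((hd.fun_mul (hd.const_add 1)).div_const 2).fun_sub (hr.fun_mul hd)).fun_sub
    (((hasDerivAt_id t).const_mul ((-1 : ℝ) ^ n)).fun_mul
      (hd.add_const (2 * n + 2 * α + 1)))).fun_div (hasDerivAt_id t) ht.ne'
  have hev : deriv (R α n) =ᶠ[nhds t] fun s => (R α n s * (1 + R α n s) / 2
      - auxR α n s * R α n s - (-1) ^ n * id s * (R α n s + (2 * n + 2 * α + 1))) / id s := by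
    filter_upwards [Ioi_mem_nhds ht] with s hs
    exact (hasDerivAt_R hα hs n).deriv
  have hd2 := hf.congr_of_eventuallyEq hev
  refine ⟨hd.differentiableAt, hd2.differentiableAt, ?_⟩
  have hR := R_pos hα ht n
  have ha := two_mul_natCast_add_pos hα n
  have hσ : ((-1 : ℝ) ^ n) ^ 2 = 1 := by rw [← pow_mul, mul_comm, pow_mul]; simp
  refine painleve_polynomial_identity (r := auxR α n t) (r₁ := deriv (auxR α n) t) ht.ne' hR.ne'
    (add_pos hR ha).ne' hσ hd.deriv ?_ ?_
  · rw [hr.deriv]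
    -- Completing the square: (r+n)(r+n+2α) = (r+(a-1)/2)² - α² with a = 2n+2α+1.
    congr 4
    ring
  · rw [hd2.deriv, hr.deriv, hd.deriv]
    simp only [id]
    field_simp
    ring

theorem painleve_identity_of_polynomial_identity {t R R₁ R₂ a α σ : ℝ} (ht : t ≠ 0) (hR : R ≠ 0)
    (ha : a ≠ 0) (hRa : a + R ≠ 0)
    (hpoly : 8 * t ^ 2 * R * (a + R) * R₂ - 4 * t ^ 2 * (2 * a + 3 * R) * R₁ ^ 2
      + 8 * t * (a + R) * R * R₁
      - R ^ 5 - 2 * a * R ^ 4 - (a ^ 2 - 4 * α ^ 2 - 4 * t ^ 2 - 4 * σ * t) * R ^ 3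
      + 8 * t * a * (σ + 2 * t) * R ^ 2 + 4 * t * a ^ 2 * (σ + 5 * t) * R
      + 8 * t ^ 2 * a ^ 3 = 0) :
    R₂ / a = (3 * (1 + R / a) - 1) * (R₁ / a) ^ 2 / (2 * (1 + R / a) * (1 + R / a - 1))
      - R₁ / a / t
      + (1 + R / a - 1) ^ 2 / t ^ 2
        * (a ^ 2 * (1 + R / a) / 8 - α ^ 2 / (2 * (1 + R / a)))
      - σ * (1 + R / a) / (2 * t)
      - (1 + R / a) * (1 + R / a + 1) / (2 * (1 + R / a - 1)) := by
  have e : 1 + R / a = (a + R) / a := by field_simp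
  have e' : (a + R) / a - 1 = R / a := by field_simp; ring
  rw [e, e']
  field_simp
  linear_combination 2 * hpoly

theorem deriv_S (α : ℝ) (n : ℕ) :
    deriv (S α n) = fun t => deriv (R α n) t / (2 * n + 2 * α + 1) := by
  funext t
  have : S α n = fun t => 1 + R α n t / (2 * n + 2 * α + 1) := rfl
  rw [this, deriv_const_add, deriv_div_const]

theorem S_second_order (hα : 0 < α) (ht : 0 < t) (n : ℕ) :
    deriv (deriv (S α n)) t =
      (3 * S α n t - 1) * (deriv (S α n) t) ^ 2 / (2 * S α n t * (S α n t - 1))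
        - deriv (S α n) t / t
        + (S α n t - 1) ^ 2 / t ^ 2
          * ((2 * n + 2 * α + 1) ^ 2 * S α n t / 8 - α ^ 2 / (2 * S α n t))
        - (-1) ^ n * S α n t / (2 * t)
        - S α n t * (S α n t + 1) / (2 * (S α n t - 1)) := by
  have hR := R_pos hα ht n
  have ha := two_mul_natCast_add_pos hα n
  rw [deriv_S, deriv_div_const]
  exact painleve_identity_of_polynomial_identity ht.ne' hR.ne' ha.ne' (add_pos ha hR).ne'
    (R_second_order hα ht n).2.2

theorem one_lt_S (hα : 0 < α) (ht : 0 < t) (n : ℕ) : 1 < S α n t :=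
  lt_add_of_pos_right 1 (div_pos (R_pos hα ht n) (two_mul_natCast_add_pos hα n))

theorem isPainleveVSolution_S (hα : 0 < α) (n : ℕ) :
    IsPainleveVSolution ((2 * n + 2 * α + 1) ^ 2 / 8) (-α ^ 2 / 2) (-(-1) ^ n / 2) (-1 / 2)
      (Set.Ioi 0) (S α n) := by
  intro t (ht : 0 < t)
  have hS := one_lt_S hα ht n
  have hS0 : S α n t ≠ 0 := (one_pos.trans hS).ne'
  have hS1 : S α n t - 1 ≠ 0 := (sub_pos.2 hS).ne'
  obtain ⟨hd, hd2, -⟩ := R_second_order hα ht n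
  refine ⟨ht.ne', hS0, hS.ne', (hd.div_const _).const_add 1, ?_, ?_⟩
  · rw [deriv_S]
    exact hd2.div_const _
  · rw [S_second_order hα ht n]
    field_simp
    ring

end Painleve
end SingularJacobi
end

theorem theorem3p2 (α : ℝ) (hα : 0 < α) (n : ℕ) :
    -- the nonlinear equation for `R_n`
    (∀ t : ℝ, 0 < t →
      DifferentiableAt ℝ (SingularJacobi.R α n) t ∧
      DifferentiableAt ℝ (deriv (SingularJacobi.R α n)) t ∧
      8 * t ^ 2 * SingularJacobi.R α n t * (2 * n + 2 * α + 1 + SingularJacobi.R α n t)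
            * deriv (deriv (SingularJacobi.R α n)) t
          - 4 * t ^ 2 * (4 * n + 4 * α + 2 + 3 * SingularJacobi.R α n t)
            * (deriv (SingularJacobi.R α n) t) ^ 2
          + 8 * t * (2 * n + 2 * α + 1 + SingularJacobi.R α n t) * SingularJacobi.R α n t
            * deriv (SingularJacobi.R α n) t
          - SingularJacobi.R α n t ^ 5
          - 2 * (2 * n + 2 * α + 1) * SingularJacobi.R α n t ^ 4
          - (4 * (n : ℝ) ^ 2 + 4 * (2 * α + 1) * n + 4 * α + 1 - 4 * t ^ 2 - 4 * (-1) ^ n * t)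
            * SingularJacobi.R α n t ^ 3
          + 8 * t * (2 * n + 2 * α + 1) * ((-1) ^ n + 2 * t) * SingularJacobi.R α n t ^ 2
          + 4 * t * (2 * n + 2 * α + 1) ^ 2 * ((-1) ^ n + 5 * t) * SingularJacobi.R α n t
          + 8 * t ^ 2 * (2 * n + 2 * α + 1) ^ 3 = 0) ∧
    -- the explicit equation for `S_n`
    (∀ t : ℝ, 0 < t →
      deriv (deriv (SingularJacobi.S α n)) t =
        (3 * SingularJacobi.S α n t - 1) * (deriv (SingularJacobi.S α n) t) ^ 2
            / (2 * SingularJacobi.S α n t * (SingularJacobi.S α n t - 1))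
          - deriv (SingularJacobi.S α n) t / t
          + (SingularJacobi.S α n t - 1) ^ 2 / t ^ 2
            * ((2 * n + 2 * α + 1) ^ 2 * SingularJacobi.S α n t / 8
              - α ^ 2 / (2 * SingularJacobi.S α n t))
          - (-1) ^ n * SingularJacobi.S α n t / (2 * t)
          - SingularJacobi.S α n t * (SingularJacobi.S α n t + 1)
            / (2 * (SingularJacobi.S α n t - 1))) ∧
    -- it is the fifth Painlevé equation with the stated parameters
    SingularJacobi.IsPainleveVSolution
      ((2 * n + 2 * α + 1) ^ 2 / 8) (-α ^ 2 / 2) (-(-1) ^ n / 2) (-1 / 2)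
      (Set.Ioi 0) (SingularJacobi.S α n) := by
  refine ⟨fun t ht => ?_, fun t ht => SingularJacobi.S_second_order hα ht n,
    SingularJacobi.isPainleveVSolution_S hα n⟩
  obtain ⟨h1, h2, h3⟩ := SingularJacobi.R_second_order hα ht n
  refine ⟨h1, h2, ?_⟩
  -- The cubic coefficient agrees because (2n+2α+1)² - 4α² = 4n² + 4(2α+1)n + 4α + 1.
  linear_combination h3
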